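/- Let $N\ge 0$, $d\ge 1$ and $k\ge d-1$ be integers. On $\mathbb{P}^N=\mathbb{P}^N(\mathbb{C})$ let $U_i=\{X_i\neq 0\}$ $(0\le i\le N)$ be the standard affine charts, with affine coordinates $X_l/X_i$, $l\ne i$. For $n\ge 0$ let $E^{GG}_{k,n}$ be the Green–Griffiths bundle of order $k$ and degree $n$: over $U_i$, its fibre consists of the polynomials in the derivatives of orders $1,\dots,k$ of the affine coordinates, all of whose monomials have weight $n$ (a derivative of order $m$ having weight $m$); such polynomials are viewed as functions on $k$-jets of holomorphic curves, and the changes of charts are those induced by differentiating the changes of affine coordinates along holomorphic curves. Let $$H^0\Big(\mathbb{P}^N,\ \bigoplus_{n\ge 0}E^{GG}_{k,n}\otimes\mathcal{O}(d)\Big)$$ be the complex vector space of global holomorphic sections, that is, of families $(s_0,\dots,s_N)$, where $s_i$ is a function on $U_i$ with values in the polynomials in these derivatives, with holomorphic coefficients, such that $s_i=(X_j/X_i)^d\,s_j$ over $U_i\cap U_j$ for all $i,j$. Write $x_j=X_j/X_0$ for the affine coordinates on $U_0$. Let $\mathcal{B}^{N+}$ be the set of $N$-tuples $\alpha=(\alpha^1,\dots,\alpha^N)$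 of finite, possibly empty, strictly increasing sequences $\alpha^j=(\alpha^j_1<\dots<\alpha^j_{n_j})$ of natural numbers all of whose terms satisfy $\alpha^j_i\ge n_{j+1}+\dots+n_N$. Let $M(\alpha)$ be the largest of all the numbers $\alpha^j_i$ (with $M(\alpha)=0$ if all the sequences are empty). Let $\Delta_0(\alpha)$ be the square matrix of size $n_1+\dots+n_N$ whose columns are, from left to right, $$\mathcal{C}_{\alpha^N_1}(x_N),\dots,\mathcal{C}_{\alpha^N_{n_N}}(x_N),\ \mathcal{C}_{\alpha^{N-1}_1}(x_{N-1}),\dots,\ \mathcal{C}_{\alpha^1_{n_1}}(x_1),$$ where the entry of $\mathcal{C}_a(x)$ on line $r=0,1,2,\dots$ is $\binom{a}{r}x^{(a-r)}$, which is $0$ for $r>a$. (The determinant of the empty matrix is $1$.) Then $$\dim H^0\Big(\mathbb{P}^N,\ \bigoplus_{n\ge 0}E^{GG}_{k,n}\otimes\mathcal{O}(d)\Big)=(N+1)^d .$$ More precisely, for every $\alpha\in\mathcal{B}^{N+}$ with $M(\alpha)\le d-1$ there is a global holomorphic section whose restriction to $U_0$ is the polynomial $\det\Delta_0(\alpha)$,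 and these sections form a basis of this space. Moreover every global holomorphic section is polynomial: each of its local sections $s_i$ is a polynomial in the affine coordinates of $U_i$ and their derivatives. So the same dimension and basis hold for the space of polynomial sections. -/

import Mathlib

namespace GreenGriffiths

/-! ### Projective space, its standard affine charts, holomorphic curves and their jets -/

/-- The projective space of dimension `N` over the complex numbers. -/
abbrev PSpace (N : ℕ) : Type := Projectivization ℂ (Fin (N + 1) → ℂ)

/-- The ratio `X_j / X_i` of two homogeneous coordinates (only meaningful where `X_i ≠ 0`). -/
noncomputable def ratio {N : ℕ} (i j : Fin (N + 1)) (p : PSpace N) : ℂ := p.rep j / p.rep i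

/-- The ratio does not depend on the chosen homogeneous coordinates. -/
theorem ratio_mk {N : ℕ} (i j : Fin (N + 1)) (v : Fin (N + 1) → ℂ) (hv : v ≠ 0) :
    ratio i j (Projectivization.mk ℂ v hv) = v j / v i := by
  obtain ⟨a, ha⟩ := Projectivization.exists_smul_eq_mk_rep ℂ v hv
  have h : ∀ l, (Projectivization.mk ℂ v hv).rep l = (a : ℂ) * v l := fun l => by
    rw [← ha]; rfl
  unfold ratio
  rw [h, h, mul_div_mul_left _ _ a.ne_zero]

/-- The open set `U_i = {X_i ≠ 0}`. -/
def chartDomain {N : ℕ} (i : Fin (N + 1)) : Set (PSpace N) := {p | p.rep i ≠ 0}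

theorem mk_mem_chartDomain {N : ℕ} (i : Fin (N + 1)) (v : Fin (N + 1) → ℂ) (hv : v ≠ 0) :
    Projectivization.mk ℂ v hv ∈ chartDomain i ↔ v i ≠ 0 := by
  obtain ⟨a, ha⟩ := Projectivization.exists_smul_eq_mk_rep ℂ v hv
  have h : (Projectivization.mk ℂ v hv).rep i = (a : ℂ) * v i := by rw [← ha]; rfl
  simp [chartDomain, h]

/-- The chart `φ_i : U_i → ℂ^N`, whose components are the `X_l / X_i` with `l ≠ i`, in increasing
order of `l`. For `i = 0` the component of index `a : Fin N` is `X_{a+1} / X_0`. -/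
noncomputable def chart {N : ℕ} (i : Fin (N + 1)) (p : PSpace N) : Fin N → ℂ :=
  fun a => ratio i (i.succAbove a) p

/-- `γ` is, near the time `0`, a curve in `U_i` which is holomorphic when read in the chart `φ_i`. -/
def HolomorphicInChart {N : ℕ} (i : Fin (N + 1)) (γ : ℂ → PSpace N) : Prop :=
  (∀ᶠ t in nhds (0 : ℂ), γ t ∈ chartDomain i) ∧ AnalyticAt ℂ (fun t => chart i (γ t)) 0

/-- The `k`-jet at time `0` of a curve, read in the chart `φ_i`. The index `(a, l)` with `l : Fin k`
stands for the derivative of order `l + 1` of the affine coordinate of index `a`. -/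
noncomputable def jet {N : ℕ} (k : ℕ) (i : Fin (N + 1)) (γ : ℂ → PSpace N) : Fin N × Fin k → ℂ :=
  fun v => iteratedDeriv (v.2.val + 1) (fun t => chart i (γ t) v.1) 0

/-! ### The Green-Griffiths bundles and their twists -/

/-- Polynomials in the jet variables `x_a^{(l+1)}`, `a : Fin N`, `l : Fin k`. -/
abbrev JetPoly (N k : ℕ) : Type := MvPolynomial (Fin N × Fin k) ℂ

/-- The fibre, in a trivialization, of the Green-Griffiths bundle of order `k` and degree `n`: the
polynomials all of whose monomials have weight `n`, where a derivative of order `m` has weight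
`m`. -/
noncomputable def fibre (N k n : ℕ) : Submodule ℂ (JetPoly N k) :=
  MvPolynomial.weightedHomogeneousSubmodule ℂ (fun v : Fin N × Fin k => v.2.val + 1) n

/-- The fibre of the direct sum of these bundles over all degrees `n ≥ 0`. -/
noncomputable def fibreInf (N k : ℕ) : Submodule ℂ (JetPoly N k) := ⨆ n : ℕ, fibre N k n

/-- The sum defining `fibreInf` is direct, and it is the whole polynomial space. -/
theorem isInternal_fibre (N k : ℕ) : DirectSum.IsInternal (fibre N k) := by
  classical
  exact (MvPolynomial.weightedDecomposition ℂ
    (fun v : Fin N × Fin k => v.2.val + 1)).isInternal _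

theorem fibreInf_eq_top (N k : ℕ) : fibreInf N k = ⊤ :=
  (isInternal_fibre N k).submodule_iSup_eq_top

/-- A family `(s_0, …, s_N)` of local sections, `s_i` being defined over `U_i` and written in the
affine coordinates of `φ_i`, with values in the space of polynomials on the fibre of the bundle of
`k`-jets. -/
abbrev LocalFamily (N k : ℕ) : Type := Fin (N + 1) → (Fin N → ℂ) → JetPoly N k

/-- The coefficients of all the local sections are holomorphic functions on `ℂ^N`. -/
def IsHolomorphic {N k : ℕ} (s : LocalFamily N k) : Prop :=
  ∀ (i : Fin (N + 1)) (m : Fin N × Fin k →₀ ℕ),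
    AnalyticOnNhd ℂ (fun x => MvPolynomial.coeff m (s i x)) Set.univ

/-- The change of charts of the twist by `O(d)`: at every point of `U_i ∩ U_j`, and on the `k`-jet
of every holomorphic curve through it, the values of `s_i` and `s_j` satisfy
`s_i = (X_j / X_i) ^ d * s_j`. -/
def IsCompatible {N k : ℕ} (d : ℕ) (s : LocalFamily N k) : Prop :=
  ∀ (i j : Fin (N + 1)) (γ : ℂ → PSpace N), HolomorphicInChart i γ → HolomorphicInChart j γ →
    MvPolynomial.eval (jet k i γ) (s i (chart i (γ 0))) =
      ratio i j (γ 0) ^ d * MvPolynomial.eval (jet k j γ) (s j (chart j (γ 0)))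

/-- The space `H^0(P^N, E_{k,∞}(d))` of global holomorphic sections of the direct sum over all
`n ≥ 0` of the Green-Griffiths bundles of order `k` and degree `n`, twisted by `O(d)`. -/
noncomputable def H0 (N k d : ℕ) : Submodule ℂ (LocalFamily N k) where
  carrier := {s | (∀ i x, s i x ∈ fibreInf N k) ∧ IsHolomorphic s ∧ IsCompatible d s}
  zero_mem' := by
    refine ⟨fun i x => Submodule.zero_mem _, fun i m => ?_, fun i j γ _ _ => ?_⟩
    · simpa using analyticOnNhd_const
    · simp
  add_mem' := by
    rintro s t ⟨hs, hs', hs''⟩ ⟨ht, ht', ht''⟩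
    refine ⟨fun i x => Submodule.add_mem _ (hs i x) (ht i x), fun i m => ?_, fun i j γ hi hj => ?_⟩
    · simp only [Pi.add_apply, MvPolynomial.coeff_add]
      exact (hs' i m).add (ht' i m)
    · have h1 := hs'' i j γ hi hj
      have h2 := ht'' i j γ hi hj
      simp only [Pi.add_apply, map_add, h1, h2, mul_add]
  smul_mem' := by
    rintro c s ⟨hs, hs', hs''⟩
    refine ⟨fun i x => Submodule.smul_mem _ c (hs i x), fun i m => ?_, fun i j γ hi hj => ?_⟩
    · simpa using (analyticOnNhd_const (v := c)).mul (hs' i m)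
    · have h1 := hs'' i j γ hi hj
      simp only [Pi.smul_apply, MvPolynomial.smul_eval, h1]
      ring

/-! ### Polynomial local sections -/

/-- The polynomial space `E = ℂ[x_a, x_a', x_a'', …]`: the variable `(a, l)` is `x_a^{(l)}`. -/
abbrev E (N : ℕ) : Type := MvPolynomial (Fin N × ℕ) ℂ

/-- The local section `f` is given by the polynomial `P`: for all values `ξ a l` of the variables
`x_a^{(l)}`, the value of `f` at the point `(x_a)` and the jet `(x_a', …, x_a^{(k)})` is that
of `P`. -/
def IsGivenBy {N k : ℕ} (f : (Fin N → ℂ) → JetPoly N k) (P : E N) : Prop :=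
  ∀ ξ : Fin N × ℕ → ℂ,
    MvPolynomial.eval (fun v => ξ (v.1, v.2.val + 1)) (f (fun a => ξ (a, 0))) =
      MvPolynomial.eval ξ P

/-- A section is polynomial if all its local sections are. -/
def IsPolynomial {N k : ℕ} (s : LocalFamily N k) : Prop :=
  ∀ i, ∃ P : E N, IsGivenBy (s i) P

/-! ### The determinants -/

/-- The index set `B^{N+}`. A strictly increasing finite sequence of natural numbers is encoded by
the finite set of its terms. The component of index `j : Fin N` is the sequence of number `j + 1`;
its terms are at least the sum of the lengths of the sequences of larger number. -/
def BPlus (N : ℕ) : Set (Fin N → Finset ℕ) :=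
  {α | ∀ j, ∀ a ∈ α j, ∑ l ∈ Finset.Ioi j, (α l).card ≤ a}

/-- `M(α)`, the largest of all the terms of the sequences (`0` if they are all empty). -/
def maxTerm {N : ℕ} (α : Fin N → Finset ℕ) : ℕ := Finset.univ.sup fun j => (α j).sup id

/-- The columns of `Δ_0(α)`, from left to right: the pair `(j, a)` stands for the column
`C_a(x_j)`; the blocks are in decreasing order of `j`, and `a` increases in each block. -/
def columns {N : ℕ} (α : Fin N → Finset ℕ) : List (Fin N × ℕ) :=
  (List.finRange N).reverse.flatMap fun j => ((α j).sort (· ≤ ·)).map fun a => (j, a)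

/-- The matrix `Δ_0(α)`: the entry of the column `C_a(x_j)` on the line `r = 0, 1, 2, …` is
`binom(a, r) x_j^{(a - r)}`, which is `0` for `r > a`. -/
noncomputable def Delta0 {N : ℕ} (α : Fin N → Finset ℕ) :
    Matrix (Fin (columns α).length) (Fin (columns α).length) (E N) :=
  Matrix.of fun r c =>
    let q := (columns α).get c
    ((q.2.choose r.val : ℕ) : E N) * MvPolynomial.X (q.1, q.2 - r.val)

end GreenGriffiths

/-! Sections. Complete Δ_0(α) to the square matrix `hmat` of size d by columns in the derivatives of
X_0. When X_0 = 1 the new columns contribute a zero block above an identity block, so the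
determinant is det Δ_0(α) (`det_hmat_eq_det_Delta0`). Multiplying the homogeneous coordinates by a
function u multiplies the matrix on the left by a triangular one with diagonal entries u (Leibniz),
hence the determinant by u^d (`det_hmat_mul`): this is the transition law of O(d). Only derivatives
of order at most d - 1 ≤ k occur.

Leading monomials. For a suitable weight, quadratic in the order of derivation, the rearrangement
inequality makes the diagonal term of Δ_0(α) its unique term of least weight. Subtracting from each
term of α its position in the list of columns turns the strictly ordered lists into weakly ordered
ones, that is, into arbitrary multisets of variables. So α ↦ (diagonal monomial) is a bijection from
B^{N+} to all monomials, and by triangularity the determinants are independent and span the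
polynomials (`linearIndependent_det_Delta0`, `span_det_Delta0`).

Polynomiality. Along a dilation c ↦ cξ of the jets, comparison with another chart gives s_i(cξ) =
c^d h(1/c) with h entire, so the Taylor coefficients of order greater than d vanish
(`iteratedDeriv_evalAt_smul_eq_zero`). This bounds the degree of s_i both in the point and in the
jet.

Bound on the terms. Write s_0 = Σ g_α det Δ_0(α), let D - 1 be the largest term that occurs and
suppose D > d. On curves with X_0 = ε + t, multiplication by ε^D turns the sum into one of
determinants of size D, and the section property makes it ε^{D-d} times a function continuous at ε =
0. So the sum vanishes for X_0 = t. There the determinants of the α without the term D - 1 are zero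
and the others are independent, again by leading monomials: a contradiction (`snd_lt_of_isGivenBy`).
The dimension follows by counting the α (`card_BPlus`). -/

namespace GreenGriffiths

/-! ### The lists of columns -/

section Columns

variable {N : ℕ}

/-- The strict order on columns: decreasing in the first component, then increasing in the
second. -/
def ColLT (p q : Fin N × ℕ) : Prop := q.1 < p.1 ∨ (p.1 = q.1 ∧ p.2 < q.2)

/-- The weak order on columns: decreasing in the first component, then increasing in the
second. -/
def ColLE (p q : Fin N × ℕ) : Prop := q.1 < p.1 ∨ (p.1 = q.1 ∧ p.2 ≤ q.2)

instance : DecidableRel (ColLE (N := N)) := fun p q => by unfold ColLE; infer_instance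

theorem ColLT.trans {p q r : Fin N × ℕ} (h : ColLT p q) (h' : ColLT q r) : ColLT p r := by
  unfold ColLT at *
  omega

theorem ColLE.trans {p q r : Fin N × ℕ} (h : ColLE p q) (h' : ColLE q r) : ColLE p r := by
  unfold ColLE at *
  omega

theorem ColLE.antisymm {p q : Fin N × ℕ} (h : ColLE p q) (h' : ColLE q p) : p = q := by
  unfold ColLE at *
  ext <;> omega

theorem ColLT.not_symm {p q : Fin N × ℕ} (h : ColLT p q) : ¬ ColLT q p := by
  unfold ColLT at *
  omega

instance : IsTrans (Fin N × ℕ) ColLT := ⟨fun _ _ _ => ColLT.trans⟩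
instance : IsTrans (Fin N × ℕ) ColLE := ⟨fun _ _ _ => ColLE.trans⟩
instance : Std.Antisymm (ColLE (N := N)) := ⟨fun _ _ => ColLE.antisymm⟩
instance : Std.Total (ColLE (N := N)) := ⟨fun p q => by unfold ColLE; omega⟩

theorem ColLT.le {p q : Fin N × ℕ} (h : ColLT p q) : ColLE p q := by
  unfold ColLT at h
  unfold ColLE
  omega

theorem ColLT.ne {p q : Fin N × ℕ} (h : ColLT p q) : p ≠ q := by
  rintro rfl
  exact h.not_symm h

theorem eq_of_pairwise_colLT {L L' : List (Fin N × ℕ)} (h : L.Pairwise ColLT)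
    (h' : L'.Pairwise ColLT) (hm : ∀ q, q ∈ L ↔ q ∈ L') : L = L' :=
  List.Perm.eq_of_pairwise' (h.imp ColLT.le) (h'.imp ColLT.le)
    ((List.perm_ext_iff_of_nodup (h.imp ColLT.ne) (h'.imp ColLT.ne)).2 hm)

theorem mem_columns {α : Fin N → Finset ℕ} {q : Fin N × ℕ} :
    q ∈ columns α ↔ q.2 ∈ α q.1 := by
  obtain ⟨j, a⟩ := q
  simp [columns]

theorem pairwise_columns (α : Fin N → Finset ℕ) : (columns α).Pairwise ColLT := by
  unfold columns
  rw [List.pairwise_flatMap]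
  constructor
  · intro j _
    rw [List.pairwise_map]
    exact ((α j).sortedLT_sort.pairwise).imp fun h => Or.inr ⟨rfl, h⟩
  · rw [List.pairwise_reverse]
    refine (List.pairwise_lt_finRange N).imp ?_
    intro a b hab x hx y hy
    simp only [List.mem_map] at hx hy
    obtain ⟨_, _, rfl⟩ := hx
    obtain ⟨_, _, rfl⟩ := hy
    exact Or.inl hab

theorem columns_injective : Function.Injective (columns (N := N)) := by
  intro α β h
  funext j
  ext a
  have := mem_columns (α := α) (q := (j, a))
  rw [h, mem_columns] at this
  exact this.symm

/-- A column (j, a) is preceded by the columns of the blocks of larger index, n in all, and by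
columns of its own block with terms in [n, a). So its position is at most n + (a - n) = a. Hence the
diagonal binomials of Δ_0(α) are nonzero. -/
theorem le_snd_columns {α : Fin N → Finset ℕ} (hα : α ∈ BPlus N) (c : ℕ)
    (hc : c < (columns α).length) : c ≤ ((columns α)[c]).2 := by
  classical
  set q := (columns α)[c] with hq
  have hqm : q.2 ∈ α q.1 := mem_columns.1 (List.getElem_mem hc)
  have hn := hα q.1 q.2 hqm
  set n := ∑ l ∈ Finset.Ioi q.1, (α l).card with hndef
  let F1 : Finset (Fin N × ℕ) :=
    (Finset.Ioi q.1).biUnion fun l => (α l).image fun b => (l, b)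
  let F2 : Finset (Fin N × ℕ) := (Finset.Ico n q.2).image fun b => (q.1, b)
  have h1 : F1.card ≤ n :=
    Finset.card_biUnion_le.trans (Finset.sum_le_sum fun l _ => Finset.card_image_le)
  have h2 : F2.card ≤ q.2 - n := by
    simpa using Finset.card_image_le (s := Finset.Ico n q.2) (f := fun b => (q.1, b))
  have hp := pairwise_columns α
  rw [List.pairwise_iff_getElem] at hp
  have h3 : (Finset.univ : Finset (Fin c)).card ≤ (F1 ∪ F2).card := by
    refine Finset.card_le_card_of_injOn
      (fun i => (columns α)[i.val]'(i.2.trans hc)) ?_ ?_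
    · intro i _
      have hlt := hp i.1 c (i.2.trans hc) hc i.2
      rw [← hq] at hlt
      have hm := mem_columns.1 (List.getElem_mem (i.2.trans hc))
      set p := (columns α)[i.val]'(i.2.trans hc)
      rcases hlt with h | ⟨h, h'⟩
      · refine Finset.mem_coe.2 (Finset.mem_union_left _ ?_)
        exact Finset.mem_biUnion.2 ⟨p.1, Finset.mem_Ioi.2 h, Finset.mem_image.2 ⟨p.2, hm, rfl⟩⟩
      · refine Finset.mem_coe.2 (Finset.mem_union_right _ ?_)
        have := hα p.1 p.2 hm
        rw [h, ← hndef] at this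
        exact Finset.mem_image.2 ⟨p.2, Finset.mem_Ico.2 ⟨this, h'⟩, by rw [← h]⟩
    · intro i _ i' _ h
      by_contra hne
      rcases lt_or_gt_of_ne hne with hlt | hlt
      · exact (hp i.1 i'.1 (i.2.trans hc) (i'.2.trans hc) hlt).ne h
      · exact (hp i'.1 i.1 (i'.2.trans hc) (i.2.trans hc) hlt).ne h.symm
  have h4 := Finset.card_union_le F1 F2
  simp only [Finset.card_univ, Fintype.card_fin] at h3
  omega

/-- The family of finite sets with a given list of columns. -/
def ofColumns (L : List (Fin N × ℕ)) : Fin N → Finset ℕ :=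
  fun j => ((L.filter fun q => q.1 = j).map Prod.snd).toFinset

theorem mem_ofColumns {L : List (Fin N × ℕ)} {j : Fin N} {a : ℕ} :
    a ∈ ofColumns L j ↔ (j, a) ∈ L := by
  simp only [ofColumns, List.mem_toFinset, List.mem_map, List.mem_filter, decide_eq_true_eq]
  constructor
  · rintro ⟨q, ⟨hq, rfl⟩, rfl⟩
    exact hq
  · intro h
    exact ⟨_, ⟨h, rfl⟩, rfl⟩

theorem columns_ofColumns {L : List (Fin N × ℕ)} (h : L.Pairwise ColLT) :
    columns (ofColumns L) = L :=
  eq_of_pairwise_colLT (pairwise_columns _) h fun q => by rw [mem_columns, mem_ofColumns]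

/-- Converse of `le_snd_columns`: the columns of larger index all stand before the position c, so
there are at most c ≤ a of them. -/
theorem ofColumns_mem_BPlus {L : List (Fin N × ℕ)} (h : L.Pairwise ColLT)
    (hL : ∀ c (hc : c < L.length), c ≤ (L[c]).2) : ofColumns L ∈ BPlus N := by
  classical
  intro j a ha
  obtain ⟨c, hc, hca⟩ := List.getElem_of_mem (mem_ofColumns.1 ha)
  have h1 := hL c hc
  rw [hca] at h1
  refine le_trans ?_ h1
  rw [List.pairwise_iff_getElem] at h
  rw [← Finset.card_sigma]
  calc _ ≤ (L.take c).toFinset.card := by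
        refine Finset.card_le_card_of_injOn (fun x => (x.1, x.2)) ?_ ?_
        · rintro ⟨l, b⟩ hlb
          simp only [Finset.coe_sigma, Set.mem_sigma_iff, Finset.mem_coe, Finset.mem_Ioi,
            mem_ofColumns] at hlb
          obtain ⟨c', hc', hcb⟩ := List.getElem_of_mem hlb.2
          simp only [List.coe_toFinset, Set.mem_ofPred_eq]
          rw [List.mem_take_iff_getElem]
          refine ⟨c', ?_, hcb⟩
          by_contra hlt
          have hcc : c ≤ c' := by omega
          rcases hcc.eq_or_lt with rfl | hcc
          · rw [hca] at hcb
            have : j = l := congrArg Prod.fst hcb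
            exact absurd hlb.1 (by simp [this])
          · have h3 := h c c' hc hc' hcc
            rw [hca, hcb] at h3
            have h4 : j < l := hlb.1
            unfold ColLT at h3
            dsimp only at h3
            omega
        · rintro ⟨l, b⟩ _ ⟨l', b'⟩ _ hh
          obtain ⟨rfl, rfl⟩ := Prod.mk.inj hh
          rfl
    _ ≤ (L.take c).length := List.toFinset_card_le _
    _ ≤ c := by simp

/-- Subtract from the second component of each column its position. -/
def lower (L : List (Fin N × ℕ)) : List (Fin N × ℕ) := L.mapIdx fun c q => (q.1, q.2 - c)

/-- Add to the second component of each column its position. -/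
def lift (L : List (Fin N × ℕ)) : List (Fin N × ℕ) := L.mapIdx fun c q => (q.1, q.2 + c)

/-- By transitivity it suffices to compare neighbours; their positions differ by one, so strict
inequalities become weak ones. -/
theorem pairwise_lower {L : List (Fin N × ℕ)} (h : L.Pairwise ColLT) :
    (lower L).Pairwise ColLE := by
  rw [← List.isChain_iff_pairwise] at h ⊢
  rw [List.isChain_iff_getElem] at h ⊢
  intro i hi
  simp only [lower, List.length_mapIdx] at hi
  have := h i hi
  simp only [lower, List.getElem_mapIdx, ColLE, ColLT] at this ⊢
  omega

theorem pairwise_lift {L : List (Fin N × ℕ)} (h : L.Pairwise ColLE) :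
    (lift L).Pairwise ColLT := by
  rw [← List.isChain_iff_pairwise] at h ⊢
  rw [List.isChain_iff_getElem] at h ⊢
  intro i hi
  simp only [lift, List.length_mapIdx] at hi
  have := h i hi
  simp only [lift, List.getElem_mapIdx, ColLE, ColLT] at this ⊢
  omega

theorem lower_lift (L : List (Fin N × ℕ)) : lower (lift L) = L := by
  apply List.ext_getElem
  · simp [lower, lift]
  · intro i h1 h2
    simp [lower, lift]

theorem lower_injOn {L L' : List (Fin N × ℕ)} (hL : ∀ c (hc : c < L.length), c ≤ (L[c]).2)
    (hL' : ∀ c (hc : c < L'.length), c ≤ (L'[c]).2) (h : lower L = lower L') : L = L' := by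
  have hlen : L.length = L'.length := by simpa [lower] using congrArg List.length h
  apply List.ext_getElem hlen
  intro i h1 h2
  have h3 : (lower L)[i]'(by simpa [lower] using h1) =
      (lower L')[i]'(by simpa [lower] using h2) := by simp only [h]
  simp only [lower, List.getElem_mapIdx, Prod.mk.injEq] at h3
  have := hL i h1
  have := hL' i h2
  ext
  · exact congrArg Fin.val h3.1
  · omega

/-- The monomial attached to a list of columns. -/
noncomputable def mono (L : List (Fin N × ℕ)) : Fin N × ℕ →₀ ℕ :=
  Multiset.toFinsupp (lower L : Multiset (Fin N × ℕ))

/-- For the columns of α, this is the monomial of the product of the diagonal entries of Δ_0(α). -/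
theorem mono_eq_sum (L : List (Fin N × ℕ)) :
    mono L = ∑ c : Fin L.length, Finsupp.single ((L[c]).1, (L[c]).2 - c.val) 1 := by
  have : lower L = List.ofFn fun c : Fin L.length => ((L[c]).1, (L[c]).2 - c.val) := by
    apply List.ext_getElem
    · simp [lower]
    · intro i h1 h2
      simp [lower]
  rw [mono, this, List.ofFn_eq_map, ← Multiset.map_coe]
  have h2 : ∀ (s : Multiset (Fin L.length)) (f : Fin L.length → Fin N × ℕ),
      Multiset.toFinsupp (s.map f) = (s.map fun c => Finsupp.single (f c) 1).sum := by
    intro s f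
    induction s using Multiset.induction with
    | empty => simp
    | cons a s ih => rw [Multiset.map_cons, Multiset.map_cons, Multiset.sum_cons,
        ← Multiset.singleton_add, map_add, ih, Multiset.toFinsupp_singleton]
  rw [h2]
  rfl

theorem mono_injOn {L L' : List (Fin N × ℕ)} (h : L.Pairwise ColLT) (h' : L'.Pairwise ColLT)
    (hL : ∀ c (hc : c < L.length), c ≤ (L[c]).2)
    (hL' : ∀ c (hc : c < L'.length), c ≤ (L'[c]).2) (he : mono L = mono L') : L = L' := by
  refine lower_injOn hL hL' ?_
  refine List.Perm.eq_of_pairwise' (pairwise_lower h) (pairwise_lower h') ?_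
  exact Multiset.coe_eq_coe.1 (Multiset.toFinsupp.injective he)

theorem mono_columns_injOn {α β : Fin N → Finset ℕ} (hα : α ∈ BPlus N) (hβ : β ∈ BPlus N)
    (h : mono (columns α) = mono (columns β)) : α = β :=
  columns_injective (mono_injOn (pairwise_columns α) (pairwise_columns β) (le_snd_columns hα)
    (le_snd_columns hβ) h)

/-- Sort the variables of m, with multiplicity, and add to each order of derivation its position. -/
theorem exists_mono_columns_eq (m : Fin N × ℕ →₀ ℕ) :
    ∃ α ∈ BPlus N, mono (columns α) = m := by
  let L := (Finsupp.toMultiset m).sort ColLE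
  have hL : L.Pairwise ColLE := Multiset.pairwise_sort _ _
  refine ⟨ofColumns (lift L), ofColumns_mem_BPlus (pairwise_lift hL) ?_, ?_⟩
  · intro c hc
    simp [lift]
  · rw [columns_ofColumns (pairwise_lift hL), mono, lower_lift, Multiset.sort_eq]
    exact Finsupp.toMultiset_toFinsupp m

theorem maxTerm_le_iff {α : Fin N → Finset ℕ} {M : ℕ} :
    maxTerm α ≤ M ↔ ∀ q ∈ columns α, q.2 ≤ M := by
  simp only [maxTerm, Finset.sup_le_iff, Finset.mem_univ, true_imp_iff, id, mem_columns]
  exact ⟨fun h q hq => h q.1 q.2 hq, fun h j a ha => h (j, a) ha⟩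

theorem length_columns_le {α : Fin N → Finset ℕ} (hα : α ∈ BPlus N) {D : ℕ}
    (hD : ∀ q ∈ columns α, q.2 < D) : (columns α).length ≤ D := by
  by_contra h
  have h1 : D < (columns α).length := by omega
  have := le_snd_columns hα D h1
  have := hD _ (List.getElem_mem h1)
  omega

end Columns

/-! ### Counting -/

/-- The elements of `BPlus N` shifted by `o`, all of whose terms are less than `d`. -/
def shiftedBPlus (N o d : ℕ) : Set (Fin N → Finset ℕ) :=
  {α | ∀ j, ∀ a ∈ α j, o + ∑ l ∈ Finset.Ioi j, (α l).card ≤ a ∧ a < d}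

/-- The last sequence is constrained by the shift alone, and its length is added to the shift of all
the others; this is the recursion behind the count. -/
theorem snoc_mem_shiftedBPlus {N o d : ℕ} (α : Fin N → Finset ℕ) (S : Finset ℕ) :
    (Fin.snoc α S : Fin (N + 1) → Finset ℕ) ∈ shiftedBPlus (N + 1) o d ↔
      S ⊆ Finset.Ico o d ∧ α ∈ shiftedBPlus N (o + S.card) d := by
  have key : ∀ j : Fin N, ∑ l ∈ Finset.Ioi j.castSucc,
      ((Fin.snoc α S : Fin (N + 1) → Finset ℕ) l).card =
      S.card + ∑ l ∈ Finset.Ioi j, (α l).card := by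
    intro j
    have h1 : ∀ {M : ℕ} (j : Fin M) (f : Fin M → ℕ),
        ∑ l ∈ Finset.Ioi j, f l = ∑ l, if j < l then f l else 0 := by
      intro M j f
      rw [← Finset.sum_filter]
      congr 1
      ext; simp
    rw [h1, h1, Fin.sum_univ_castSucc]
    simp [Fin.castSucc_lt_last, add_comm]
  have hlast : Finset.Ioi (Fin.last N) = ∅ := by
    ext x; simp [Fin.le_last]
  simp only [shiftedBPlus, Set.mem_ofPred_eq, Fin.forall_fin_succ', Fin.snoc_castSucc,
    Fin.snoc_last, key, hlast, Finset.sum_empty, add_zero, Finset.subset_iff, Finset.mem_Ico,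
    add_assoc]
  tauto

/-- A last sequence S inside [o, d) leaves (N + 1)^(d - o - |S|) choices; the sum over S is (1 + (N
+ 1))^(d - o) by the binomial theorem. -/
theorem ncard_shiftedBPlus (N : ℕ) : ∀ o d : ℕ,
    Nat.card (shiftedBPlus N o d) = (N + 1) ^ (d - o) ∧ Finite (shiftedBPlus N o d) := by
  induction N with
  | zero =>
    intro o d
    have : Unique (shiftedBPlus 0 o d) :=
      { default := ⟨Fin.elim0, fun j => j.elim0⟩
        uniq := fun a => Subtype.ext (Subsingleton.elim _ _) }
    exact ⟨by simp, inferInstance⟩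
  | succ N ih =>
    intro o d
    let e : shiftedBPlus (N + 1) o d ≃
        Σ S : (Finset.Ico o d).powerset, shiftedBPlus N (o + S.1.card) d :=
      { toFun := fun α =>
          have h := (snoc_mem_shiftedBPlus (o := o) (d := d) (Fin.init α.1)
            (α.1 (Fin.last N))).1 (by rw [Fin.snoc_init_self]; exact α.2)
          ⟨⟨α.1 (Fin.last N), Finset.mem_powerset.2 h.1⟩, ⟨Fin.init α.1, h.2⟩⟩
        invFun := fun x => ⟨Fin.snoc x.2.1 x.1.1, (snoc_mem_shiftedBPlus _ _).2
          ⟨Finset.mem_powerset.1 x.1.2, x.2.2⟩⟩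
        left_inv := fun α => Subtype.ext (Fin.snoc_init_self _)
        right_inv := by
          rintro ⟨⟨S, hS⟩, ⟨α, hα⟩⟩
          exact Sigma.subtype_ext (Subtype.ext (by simp)) (by simp) }
    have : ∀ S : (Finset.Ico o d).powerset, Finite (shiftedBPlus N (o + S.1.card) d) :=
      fun S => (ih _ _).2
    have hfin : Finite (shiftedBPlus (N + 1) o d) := Finite.of_equiv _ e.symm
    refine ⟨?_, hfin⟩
    rw [Nat.card_congr e, Nat.card_sigma]
    simp only [(ih _ _).1]
    have h2 := Finset.sum_pow_mul_eq_add_pow (1 : ℕ) (N + 1) (Finset.Ico o d)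
    rw [Nat.card_Ico, add_comm 1] at h2
    rw [← h2]
    refine Eq.trans ?_ (Finset.sum_coe_sort ((Finset.Ico o d).powerset)
      fun t => 1 ^ t.card * (N + 1) ^ (d - o - t.card))
    refine Finset.sum_congr rfl fun S _ => ?_
    rw [one_pow, one_mul]
    congr 1
    omega

theorem card_BPlus {N d : ℕ} (hd : 1 ≤ d) :
    Nat.card {α : Fin N → Finset ℕ // α ∈ BPlus N ∧ maxTerm α ≤ d - 1} = (N + 1) ^ d ∧
      Finite {α : Fin N → Finset ℕ // α ∈ BPlus N ∧ maxTerm α ≤ d - 1} := by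
  have h := ncard_shiftedBPlus N 0 d
  rw [Nat.sub_zero] at h
  have : shiftedBPlus N 0 d = {α | α ∈ BPlus N ∧ maxTerm α ≤ d - 1} := by
    ext α
    simp only [shiftedBPlus, BPlus, Set.mem_ofPred_eq, maxTerm_le_iff, mem_columns, zero_add]
    constructor
    · intro h
      exact ⟨fun j a ha => (h j a ha).1, fun q hq => by have := (h q.1 q.2 hq).2; omega⟩
    · rintro ⟨h1, h2⟩ j a ha
      exact ⟨h1 j a ha, by have := h2 (j, a) ha; dsimp only at this; omega⟩
  rw [this] at h
  exact h

end GreenGriffiths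

namespace GreenGriffiths

/-! ### Rearrangements -/

section Rearrangement

/-- Rearrangement inequality; in the case of equality σ is increasing, hence the identity. -/
theorem sum_perm_mul_lt_of_strictMono {D : ℕ} {B : Fin D → ℤ} (hB : StrictMono B)
    {σ : Equiv.Perm (Fin D)} (hσ : σ ≠ 1) :
    ∑ c, ((σ c).val : ℤ) * B c < ∑ c : Fin D, (c.val : ℤ) * B c := by
  have hf : StrictMono fun c : Fin D => (c.val : ℤ) := fun a b h => by
    dsimp only
    exact_mod_cast h
  have hm : Monovary (fun c : Fin D => (c.val : ℤ)) B := hf.monotone.monovary hB.monotone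
  refine hm.sum_comp_perm_mul_lt_sum_mul_iff.2 fun h => hσ ?_
  have hmono : StrictMono σ := by
    intro a b hab
    have := h (hB hab)
    simp only [Function.comp, Nat.cast_le, Fin.val_fin_le] at this
    exact lt_of_le_of_ne this fun he => hab.ne (σ.injective he)
  have := Subsingleton.elim (hmono.orderIsoOfSurjective σ σ.surjective) (OrderIso.refl (Fin D))
  exact Equiv.ext fun x => DFunLike.congr_fun this x

/-- The permutation sending `c₀` to the last element and keeping the order of the others. -/
def toLast {D : ℕ} (c₀ : Fin (D + 1)) : Equiv.Perm (Fin (D + 1)) :=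
  (finSuccEquiv' c₀).trans (finSuccEquiv' (Fin.last D)).symm

@[simp] theorem toLast_self {D : ℕ} (c₀ : Fin (D + 1)) : toLast c₀ c₀ = Fin.last D := by
  simp [toLast]

@[simp] theorem toLast_succAbove {D : ℕ} (c₀ : Fin (D + 1)) (i : Fin D) :
    toLast c₀ (c₀.succAbove i) = i.castSucc := by
  simp [toLast]

/-- Raise the value at c₀ above all the others. Both sums change by the same amount, since both
permutations send c₀ to the last element, and `toLast c₀` sorts the new values. -/
theorem sum_perm_mul_lt_of_apply_eq_last {D : ℕ} {B : Fin (D + 1) → ℤ} (hB : StrictMono B)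
    {c₀ : Fin (D + 1)} {σ : Equiv.Perm (Fin (D + 1))} (hσ : σ ≠ toLast c₀)
    (hc : σ c₀ = Fin.last D) :
    ∑ c, ((σ c).val : ℤ) * B c < ∑ c, ((toLast c₀ c).val : ℤ) * B c := by
  set B' : Fin (D + 1) → ℤ := Function.update B c₀ (B (Fin.last D) + 1) with hB'
  have hmono : StrictMono (B' ∘ (toLast c₀).symm) := by
    have h1 : (toLast c₀).symm (Fin.last D) = c₀ := by rw [Equiv.symm_apply_eq]; simp
    have h2 : ∀ i : Fin D, (toLast c₀).symm i.castSucc = c₀.succAbove i := fun i => by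
      rw [Equiv.symm_apply_eq]; simp
    intro a b hab
    induction a using Fin.lastCases with
    | last => exact absurd (Fin.le_last b) (not_le.2 hab)
    | cast a =>
      induction b using Fin.lastCases with
      | last =>
        simp only [Function.comp, h1, h2, hB', Function.update_self,
          Function.update_of_ne (Fin.succAbove_ne c₀ a)]
        have := hB.monotone (Fin.le_last (c₀.succAbove a))
        omega
      | cast b =>
        simp only [Function.comp, h2, hB', Function.update_of_ne (Fin.succAbove_ne c₀ _)]
        exact hB (Fin.strictMono_succAbove c₀ (by simpa using hab))
  have h1 : (toLast c₀).symm.trans σ ≠ 1 := fun h => hσ (by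
    ext x
    have := Equiv.congr_fun h (toLast c₀ x)
    simpa using congrArg Fin.val this)
  have h2 := sum_perm_mul_lt_of_strictMono hmono h1
  rw [← Equiv.sum_comp (toLast c₀), ← Equiv.sum_comp (toLast c₀) (fun c => (c.val : ℤ) * _)] at h2
  simp only [Function.comp, Equiv.trans_apply, Equiv.symm_apply_apply] at h2
  rw [Fin.sum_univ_succAbove _ c₀, Fin.sum_univ_succAbove _ c₀] at h2 ⊢
  simp only [hB', Function.update_self, Function.update_of_ne (Fin.succAbove_ne c₀ _), hc,
    toLast_self] at h2 ⊢
  omega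

/-- If c₁ < c₀, exchanging the images of c₁ and c₀ increases the sum by (D - σ c₀)(B c₀ - B c₁) > 0
and reduces to the case c₁ = c₀. -/
theorem sum_perm_mul_lt_of_le {D : ℕ} {B : Fin (D + 1) → ℤ} (hB : StrictMono B)
    {c₀ c₁ : Fin (D + 1)} {σ : Equiv.Perm (Fin (D + 1))} (hσ : σ ≠ toLast c₀)
    (hc : σ c₁ = Fin.last D) (hle : c₁ ≤ c₀) :
    ∑ c, ((σ c).val : ℤ) * B c < ∑ c, ((toLast c₀ c).val : ℤ) * B c := by
  rcases hle.eq_or_lt with rfl | hlt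
  · exact sum_perm_mul_lt_of_apply_eq_last hB hσ hc
  set σ' : Equiv.Perm (Fin (D + 1)) := (Equiv.swap c₁ c₀).trans σ
  have h1 : ∑ c, ((σ c).val : ℤ) * B c < ∑ c, ((σ' c).val : ℤ) * B c := by
    rw [← sub_pos, ← Finset.sum_sub_distrib]
    rw [← Finset.sum_subset (Finset.subset_univ {c₁, c₀}), Finset.sum_pair hlt.ne]
    · have h3 : σ c₀ ≠ Fin.last D := fun h => hlt.ne (σ.injective (hc.trans h.symm))
      have h4 : (σ c₀).val < D := by
        have := Fin.lt_last_iff_ne_last.2 h3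
        simpa [Fin.lt_def] using this
      have h5 := hB hlt
      simp only [σ', Equiv.trans_apply, Equiv.swap_apply_left, Equiv.swap_apply_right, hc,
        Fin.val_last]
      have : ((σ c₀).val : ℤ) < D := by exact_mod_cast h4
      nlinarith
    · intro c _ hc'
      simp only [Finset.mem_insert, Finset.mem_singleton, not_or] at hc'
      simp [σ', Equiv.swap_apply_of_ne_of_ne hc'.1 hc'.2]
  have hσ' : σ' c₀ = Fin.last D := by simp [σ', hc]
  by_cases h : σ' = toLast c₀
  · rw [← h]
    exact h1
  · exact h1.trans (sum_perm_mul_lt_of_apply_eq_last hB h hσ')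

end Rearrangement

/-! ### Leading monomials -/

section Leading

variable {τ ι : Type*}

/-- `μ` is the only monomial of `f` of least weight for `W`. -/
def IsLeading (W : (τ →₀ ℕ) → ℤ) (f : MvPolynomial τ ℂ) (μ : τ →₀ ℕ) : Prop :=
  MvPolynomial.coeff μ f ≠ 0 ∧ ∀ m ∈ f.support, m ≠ μ → W μ < W m

/-- In a linear relation, a leading monomial of least weight among those with nonzero coefficient
cannot be cancelled. -/
theorem linearIndependent_of_isLeading (W : (τ →₀ ℕ) → ℤ) (f : ι → MvPolynomial τ ℂ)
    (μ : ι → τ →₀ ℕ) (hμ : Function.Injective μ) (h : ∀ i, IsLeading W (f i) (μ i)) :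
    LinearIndependent ℂ f := by
  classical
  rw [linearIndependent_iff']
  intro s g hg
  by_contra! hne
  obtain ⟨i, his, hi⟩ := hne
  obtain ⟨i, hi', hmin⟩ := (s.filter fun i => g i ≠ 0).exists_min_image (fun i => W (μ i))
    ⟨i, Finset.mem_filter.2 ⟨his, hi⟩⟩
  rw [Finset.mem_filter] at hi'
  have h1 := congrArg (MvPolynomial.coeff (μ i)) hg
  rw [MvPolynomial.coeff_sum, Finset.sum_eq_single_of_mem i hi'.1] at h1
  · simp only [MvPolynomial.coeff_smul, smul_eq_mul, MvPolynomial.coeff_zero, mul_eq_zero] at h1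
    exact h1.elim hi'.2 (h i).1
  · intro b hb hbi
    rw [MvPolynomial.coeff_smul, smul_eq_mul, mul_eq_zero]
    by_contra! hcon
    have h2 := (h b).2 (μ i) (MvPolynomial.mem_support_iff.2 hcon.2)
      fun he => hbi (hμ he.symm)
    have h3 := hmin b (Finset.mem_filter.2 ⟨hb, hcon.1⟩)
    omega

variable [Fintype ι] [DecidableEq ι]

theorem det_monomial (κ : ι → ι → ℂ) (v : ι → ι → τ →₀ ℕ) :
    (Matrix.of fun r c => MvPolynomial.monomial (v r c) (κ r c)).det =
      ∑ σ : Equiv.Perm ι, MvPolynomial.monomial (∑ c, v (σ c) c)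
        ((Equiv.Perm.sign σ : ℤ) * ∏ c, κ (σ c) c) := by
  rw [Matrix.det_apply']
  refine Finset.sum_congr rfl fun σ _ => ?_
  have : ∏ c, MvPolynomial.monomial (v (σ c) c) (κ (σ c) c) =
      MvPolynomial.monomial (∑ c, v (σ c) c) (∏ c, κ (σ c) c) :=
    (MvPolynomial.monomial_sum_prod Finset.univ (fun c => v (σ c) c) fun c => κ (σ c) c).symm
  simp only [Matrix.of_apply]
  rw [this, ← MvPolynomial.C_mul_monomial]
  simp

theorem exists_perm_of_mem_support_det (κ : ι → ι → ℂ) (v : ι → ι → τ →₀ ℕ) {m : τ →₀ ℕ}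
    (hm : m ∈ (Matrix.of fun r c => MvPolynomial.monomial (v r c) (κ r c)).det.support) :
    ∃ σ : Equiv.Perm ι, (∀ c, κ (σ c) c ≠ 0) ∧ m = ∑ c, v (σ c) c := by
  classical
  rw [MvPolynomial.mem_support_iff, det_monomial, MvPolynomial.coeff_sum] at hm
  obtain ⟨σ, -, h⟩ := Finset.exists_ne_zero_of_sum_ne_zero hm
  rw [MvPolynomial.coeff_monomial] at h
  split_ifs at h with h1
  · refine ⟨σ, ?_, h1.symm⟩
    have := right_ne_zero_of_mul h
    rw [Finset.prod_ne_zero_iff] at this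
    exact fun c => this c (Finset.mem_univ _)
  · exact absurd rfl h

/-- The permutation of least weight is unique, so no other term of the expansion has its monomial
and nothing cancels it. -/
theorem isLeading_det (W : (τ →₀ ℕ) → ℤ) (κ : ι → ι → ℂ) (v : ι → ι → τ →₀ ℕ)
    (ρ : Equiv.Perm ι) (hρ : ∀ c, κ (ρ c) c ≠ 0)
    (h : ∀ σ : Equiv.Perm ι, σ ≠ ρ → (∀ c, κ (σ c) c ≠ 0) →
      W (∑ c, v (ρ c) c) < W (∑ c, v (σ c) c)) :
    IsLeading W (Matrix.of fun r c => MvPolynomial.monomial (v r c) (κ r c)).det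
      (∑ c, v (ρ c) c) := by
  classical
  constructor
  · rw [det_monomial, MvPolynomial.coeff_sum, Finset.sum_eq_single_of_mem ρ (Finset.mem_univ _)]
    · rw [MvPolynomial.coeff_monomial, if_pos rfl]
      refine mul_ne_zero ?_ (Finset.prod_ne_zero_iff.2 fun c _ => hρ c)
      exact_mod_cast (Equiv.Perm.sign ρ).ne_zero
    · intro σ _ hσ
      rw [MvPolynomial.coeff_monomial]
      split_ifs with he
      · by_contra hne
        have h1 := right_ne_zero_of_mul hne
        rw [Finset.prod_ne_zero_iff] at h1
        have h2 := h σ hσ fun c => h1 c (Finset.mem_univ _)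
        rw [he] at h2
        exact lt_irrefl _ h2
      · rfl
  · intro m hm hne
    obtain ⟨σ, h1, rfl⟩ := exists_perm_of_mem_support_det κ v hm
    exact h σ (fun he => hne (by rw [he])) h1

end Leading

/-! ### The homogeneous matrices -/

section Homogeneous

variable {N : ℕ}

/-- The columns of the homogeneous matrix: those of `Δ_0(α)`, followed by columns in the
homogeneous variable of index `0`. -/
def extCol (α : Fin N → Finset ℕ) (c : ℕ) : Fin (N + 1) × ℕ :=
  if h : c < (columns α).length then (((columns α)[c]).1.succ, ((columns α)[c]).2) else (0, c)

/-- The homogeneous matrix, in the derivatives `Z j l` of the homogeneous coordinates. -/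
def hmat {R : Type*} [CommRing R] (α : Fin N → Finset ℕ) (D : ℕ) (Z : Fin (N + 1) → ℕ → R) :
    Matrix (Fin D) (Fin D) R :=
  Matrix.of fun r c =>
    ((extCol α c).2.choose r.val : R) * Z (extCol α c).1 ((extCol α c).2 - r)

theorem map_det_hmat {R S : Type*} [CommRing R] [CommRing S] (f : R →+* S)
    (α : Fin N → Finset ℕ) (D : ℕ) (Z : Fin (N + 1) → ℕ → R) :
    f (hmat α D Z).det = (hmat α D fun j l => f (Z j l)).det := by
  rw [RingHom.map_det]
  congr 1
  ext r c
  simp [hmat]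

theorem extCol_snd_lt {α : Fin N → Finset ℕ} {D : ℕ} (hD : ∀ q ∈ columns α, q.2 < D) {c : ℕ}
    (hc : c < D) : (extCol α c).2 < D := by
  unfold extCol
  split_ifs with h
  · exact hD _ (List.getElem_mem h)
  · exact hc

theorem le_extCol_snd {α : Fin N → Finset ℕ} (hα : α ∈ BPlus N) (c : ℕ) :
    c ≤ (extCol α c).2 := by
  unfold extCol
  split_ifs with h
  · exact le_snd_columns hα c h
  · exact le_rfl

theorem det_hmat_congr {R : Type*} [CommRing R] {α : Fin N → Finset ℕ} {D : ℕ}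
    (hD : ∀ q ∈ columns α, q.2 < D) {Z Z' : Fin (N + 1) → ℕ → R}
    (h : ∀ j, ∀ l < D, Z j l = Z' j l) : (hmat α D Z).det = (hmat α D Z').det := by
  congr 1
  ext r c
  simp only [hmat, Matrix.of_apply]
  rw [h]
  have := extCol_snd_lt hD c.2
  omega

/-- Multiplying the homogeneous coordinates by a function multiplies the determinant of the
homogeneous matrix of size `D` by the power `D` of this function. -/
theorem det_hmat_mul {R : Type*} [CommRing R] {α : Fin N → Finset ℕ} {D : ℕ}
    (hD : ∀ q ∈ columns α, q.2 < D) {Z Y : Fin (N + 1) → ℕ → R} {u : ℕ → R}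
    (h : ∀ j, ∀ l < D, Z j l = ∑ s ∈ Finset.range (l + 1), (l.choose s : R) * u s * Y j (l - s)) :
    (hmat α D Z).det = u 0 ^ D * (hmat α D Y).det := by
  -- The matrix of Leibniz' rule, upper triangular with diagonal entries u 0.
  let T : Matrix (Fin D) (Fin D) R :=
    Matrix.of fun r s => (s.val.choose r.val : R) * u (s.val - r.val)
  have hT : T.det = u 0 ^ D := by
    rw [Matrix.det_of_isUpperTriangular]
    · simp [T]
    · intro r s hrs
      have : s.val < r.val := hrs
      simp [T, Nat.choose_eq_zero_of_lt this]
  have hmul : hmat α D Z = T * hmat α D Y := by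
    ext r c
    have ha := extCol_snd_lt hD c.2
    simp only [hmat, T, Matrix.mul_apply, Matrix.of_apply]
    set a := (extCol α c).2
    set j := (extCol α c).1
    rw [Fin.sum_univ_eq_sum_range (fun s => ((s.choose r.val : R) * u (s - r.val)) *
      ((a.choose s : R) * Y j (a - s))) D]
    by_cases hra : r.val ≤ a
    · rw [h j _ (by omega), Finset.mul_sum]
      -- Split the lines into those before r, those from r to a, and those after a; the binomials
      -- kill the two outer ranges. In the middle, binom(a, r+s) binom(r+s, r) = binom(a, r)
      -- binom(a-r, s).
      obtain ⟨e, he⟩ : ∃ e, D = r.val + ((a - r.val + 1) + e) := ⟨D - (a + 1), by omega⟩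
      rw [show Finset.range D = Finset.range (r.val + ((a - r.val + 1) + e)) by rw [← he],
        Finset.sum_range_add _ r.val, Finset.sum_range_add _ (a - r.val + 1)]
      rw [Finset.sum_eq_zero (s := Finset.range r.val), zero_add,
        Finset.sum_eq_zero (s := Finset.range e), add_zero]
      · refine Finset.sum_congr rfl fun s _ => ?_
        have h1 := Nat.choose_mul (n := a) (k := r.val + s) (s := r.val) (by omega)
        rw [Nat.add_sub_cancel_left] at h1
        have h2 : (a.choose (r.val + s) : R) * ((r.val + s).choose r.val : R) =
            (a.choose r.val : R) * ((a - r.val).choose s : R) := by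
          rw [← Nat.cast_mul, h1, Nat.cast_mul]
        rw [Nat.add_sub_cancel_left, Nat.sub_add_eq]
        linear_combination (-(u s * Y j (a - r.val - s))) * h2
      · intro s _
        rw [Nat.choose_eq_zero_of_lt (show a < r.val + (a - r.val + 1 + s) by omega)]
        simp
      · intro s hs
        rw [Nat.choose_eq_zero_of_lt (Finset.mem_range.1 hs)]
        simp
    · rw [Nat.choose_eq_zero_of_lt (by omega : a < r.val), Nat.cast_zero, zero_mul]
      refine (Finset.sum_eq_zero fun s _ => ?_).symm
      by_cases hs : s < r.val
      · simp [Nat.choose_eq_zero_of_lt hs]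
      · simp [Nat.choose_eq_zero_of_lt (show a < s by omega)]
  rw [hmul, Matrix.det_mul, hT]

theorem det_hmat_eq_det_Delta0 {α : Fin N → Finset ℕ} {D : ℕ} (hD : (columns α).length ≤ D)
    {Z : Fin (N + 1) → ℕ → E N} (h0 : ∀ l, Z 0 l = if l = 0 then 1 else 0)
    (hZ : ∀ j l, Z (Fin.succ j) l = MvPolynomial.X (j, l)) :
    (hmat α D Z).det = (Delta0 α).det := by
  obtain ⟨m, rfl⟩ := Nat.exists_eq_add_of_le hD
  rw [← Matrix.det_submatrix_equiv_self (finSumFinEquiv (m := (columns α).length) (n := m))]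
  rw [← Matrix.fromBlocks_toBlocks ((hmat α _ Z).submatrix finSumFinEquiv finSumFinEquiv)]
  have h12 : ((hmat α _ Z).submatrix (finSumFinEquiv (m := (columns α).length) (n := m))
      finSumFinEquiv).toBlocks₁₂ = 0 := by
    ext1 r c
    simp only [Matrix.toBlocks₁₂, Matrix.of_apply, Matrix.submatrix_apply,
      finSumFinEquiv_apply_left, finSumFinEquiv_apply_right, hmat, extCol, Fin.val_natAdd,
      Fin.val_castAdd, Matrix.zero_apply]
    rw [dif_neg (by omega)]
    simp only [h0]
    rw [if_neg (by omega), mul_zero]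
  have h22 : ((hmat α _ Z).submatrix (finSumFinEquiv (m := (columns α).length) (n := m))
      finSumFinEquiv).toBlocks₂₂ = 1 := by
    ext1 r c
    simp only [Matrix.toBlocks₂₂, Matrix.of_apply, Matrix.submatrix_apply,
      finSumFinEquiv_apply_right, hmat, extCol, Fin.val_natAdd]
    rw [dif_neg (by omega)]
    simp only [h0, Matrix.one_apply]
    rcases lt_trichotomy r.val c.val with h | h | h
    · rw [if_neg (by omega), if_neg (by omega), mul_zero]
    · obtain rfl := Fin.ext h
      simp
    · rw [Nat.choose_eq_zero_of_lt (by omega), if_neg (fun he => h.ne (by rw [he]) : ¬r = c)]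
      simp
  rw [h12, h22, Matrix.det_fromBlocks_zero₁₂, Matrix.det_one, mul_one]
  congr 1
  ext1 r c
  simp [Matrix.toBlocks₁₁, hmat, extCol, hZ, Delta0]

end Homogeneous

end GreenGriffiths

namespace GreenGriffiths

/-! ### Leading monomials of the determinants -/

section Weights

variable {N : ℕ}

theorem mono_eq_sum_fin (L : List (Fin N × ℕ)) {D : ℕ} (hD : L.length ≤ D) :
    mono L = ∑ c : Fin D,
      if h : c.val < L.length then Finsupp.single ((L[c.val]).1, (L[c.val]).2 - c.val) 1 else 0 := by
  obtain ⟨m, rfl⟩ := Nat.exists_eq_add_of_le hD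
  rw [Fin.sum_univ_add, mono_eq_sum, Finset.sum_eq_zero (s := Finset.univ) (ι := Fin m), add_zero]
  · refine Finset.sum_congr rfl fun c _ => ?_
    rw [dif_pos (by simp)]
    rfl
  · intro c _
    rw [dif_neg (by simp)]

/-- The derivatives of the homogeneous coordinates, when that of index `0` is `t ^ e / e!` and the
other ones are generic. -/
noncomputable def genericZ (N e : ℕ) : Fin (N + 1) → ℕ → E N :=
  Fin.cases (fun l => if l = e then 1 else 0) fun j l => MvPolynomial.X (j, l)

@[simp] theorem genericZ_zero (N e l : ℕ) : genericZ N e 0 l = if l = e then 1 else 0 := rfl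

@[simp] theorem genericZ_succ (N e : ℕ) (j : Fin N) (l : ℕ) :
    genericZ N e j.succ l = MvPolynomial.X (j, l) := rfl

/-- The coefficients of the entries of the homogeneous matrix for `genericZ`. -/
noncomputable def entryCoeff (α : Fin N → Finset ℕ) (e r c : ℕ) : ℂ :=
  if c < (columns α).length ∨ c - r = e then ((extCol α c).2.choose r : ℂ) else 0

/-- The monomials of the entries of the homogeneous matrix for `genericZ`. -/
noncomputable def entryMono (α : Fin N → Finset ℕ) (r c : ℕ) : Fin N × ℕ →₀ ℕ :=
  if h : c < (columns α).length then
    Finsupp.single (((columns α)[c]).1, ((columns α)[c]).2 - r) 1 else 0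

/-- Every entry is a single term, so the expansion of the determinant is controlled one permutation
at a time. -/
theorem hmat_genericZ (α : Fin N → Finset ℕ) (D e : ℕ) :
    hmat α D (genericZ N e) = Matrix.of fun r c : Fin D =>
      MvPolynomial.monomial (entryMono α r c) (entryCoeff α e r c) := by
  ext1 r c
  simp only [hmat, Matrix.of_apply, entryMono, entryCoeff]
  by_cases h : c.val < (columns α).length
  · rw [dif_pos h, if_pos (Or.inl h)]
    simp only [extCol, dif_pos h, genericZ_succ]
    rw [← mul_one ((_ : ℕ) : ℂ), ← MvPolynomial.C_mul_monomial]
    simp [MvPolynomial.X]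
  · rw [dif_neg h]
    simp only [h, false_or, extCol, dif_neg, not_false_iff, genericZ_zero]
    split_ifs <;> simp

theorem entryCoeff_ne_zero {α : Fin N → Finset ℕ} {e r c : ℕ} :
    entryCoeff α e r c ≠ 0 ↔
      (c < (columns α).length ∨ c - r = e) ∧ r ≤ (extCol α c).2 := by
  unfold entryCoeff
  split_ifs with h
  · simp only [h, true_and, ne_eq, Nat.cast_eq_zero, Nat.choose_eq_zero_iff, not_lt]
  · simp [h]

/-- The weights of the monomials. -/
noncomputable def wt (K : ℕ) : (Fin N × ℕ →₀ ℕ) →+ ℤ :=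
  Finsupp.weight fun q : Fin N × ℕ => (q.2 : ℤ) ^ 2 - 2 * K * (q.1.val + 1) * q.2

/-- The slopes of the columns. -/
def slope (α : Fin N → Finset ℕ) (K c : ℕ) : ℤ :=
  ((extCol α c).2 : ℤ) - K * (extCol α c).1.val

/-- As K exceeds every term, lowering the index of the variable by one outweighs any change of the
term. The added columns, of index 0, have slope equal to their position. -/
theorem slope_lt_slope {α : Fin N → Finset ℕ} {K : ℕ} (hK : ∀ q ∈ columns α, q.2 < K) {c c' : ℕ}
    (h : c < c') : slope α K c < slope α K c' := by
  unfold slope extCol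
  split_ifs with h1 h2 h2
  · have h3 := pairwise_columns α
    rw [List.pairwise_iff_getElem] at h3
    have h3 := h3 c c' h1 h2 h
    have h4 := hK _ (List.getElem_mem h1)
    rcases h3 with h3 | ⟨h3, h3'⟩
    · have h5 : ((columns α)[c'].1.val : ℤ) + 1 ≤ (columns α)[c].1.val := by exact_mod_cast h3
      have h6 : ((columns α)[c].2 : ℤ) < K := by exact_mod_cast h4
      simp only [Fin.val_succ]
      push_cast
      nlinarith
    · rw [h3]
      have : ((columns α)[c].2 : ℤ) < (columns α)[c'].2 := by exact_mod_cast h3'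
      dsimp only
      omega
  · have h4 := hK _ (List.getElem_mem h1)
    have h6 : ((columns α)[c].2 : ℤ) < K := by exact_mod_cast h4
    simp only [Fin.val_succ, Fin.val_zero]
    push_cast
    nlinarith [Int.natCast_nonneg K, Int.natCast_nonneg c', Int.natCast_nonneg (columns α)[c].1.val]
  · omega
  · simp only [Fin.val_zero]
    push_cast
    omega

/-- With J the homogeneous index, expand (a - r)² - 2KJ(a - r): the line and the column interact
only through -2r(a - KJ), which is why the weight is quadratic. An added column has a constant
entry, nonzero only for c - r = e, whence the correction e². -/
theorem wt_entryMono {α : Fin N → Finset ℕ} {e r c : ℕ} (K : ℕ) (h : entryCoeff α e r c ≠ 0) :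
    wt K (entryMono α r c) =
      (((extCol α c).2 : ℤ) ^ 2 - 2 * K * (extCol α c).1.val * (extCol α c).2 -
        (if c < (columns α).length then 0 else (e : ℤ) ^ 2)) + (r : ℤ) ^ 2
        - 2 * (r * slope α K c) := by
  rw [entryCoeff_ne_zero] at h
  unfold entryMono slope
  by_cases hc : c < (columns α).length
  · have h2 := h.2
    simp only [extCol, dif_pos hc] at h2 ⊢
    rw [if_pos hc, wt, Finsupp.weight_single, one_smul]
    dsimp only
    rw [Nat.cast_sub h2, Fin.val_succ]
    push_cast
    ring
  · have h2 := h.2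
    have h1 := h.1.resolve_left hc
    simp only [extCol, dif_neg hc] at h2 ⊢
    rw [if_neg hc, map_zero, Fin.val_zero, ← h1, Nat.cast_sub h2]
    push_cast
    ring

theorem wt_sum_lt {α : Fin N → Finset ℕ} {D e : ℕ} (K : ℕ) {σ ρ : Equiv.Perm (Fin D)}
    (hσ : ∀ c, entryCoeff α e (σ c) c ≠ 0) (hρ : ∀ c, entryCoeff α e (ρ c) c ≠ 0)
    (h : ∑ c, ((σ c).val : ℤ) * slope α K c < ∑ c, ((ρ c).val : ℤ) * slope α K c) :
    wt K (∑ c, entryMono α (ρ c) c) < wt K (∑ c, entryMono α (σ c) c) := by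
  rw [map_sum, map_sum, Finset.sum_congr rfl fun c _ => wt_entryMono K (hσ c),
    Finset.sum_congr rfl fun c _ => wt_entryMono K (hρ c)]
  simp only [Finset.sum_add_distrib, Finset.sum_sub_distrib, ← Finset.mul_sum]
  rw [Equiv.sum_comp σ fun c : Fin D => (c.val : ℤ) ^ 2,
    Equiv.sum_comp ρ fun c : Fin D => (c.val : ℤ) ^ 2]
  omega

theorem isLeading_det_hmat_genericZ_zero {α : Fin N → Finset ℕ} (hα : α ∈ BPlus N) {D K : ℕ}
    (hD : ∀ q ∈ columns α, q.2 < D) (hK : ∀ q ∈ columns α, q.2 < K) :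
    IsLeading (wt K) (hmat α D (genericZ N 0)).det (mono (columns α)) := by
  have h1 : ∀ c : Fin D, entryCoeff α 0 ((1 : Equiv.Perm (Fin D)) c) c ≠ 0 := fun c =>
    entryCoeff_ne_zero.2 ⟨Or.inr (by simp), le_extCol_snd hα c⟩
  have h2 : mono (columns α) = ∑ c : Fin D, entryMono α ((1 : Equiv.Perm (Fin D)) c) c :=
    mono_eq_sum_fin _ (length_columns_le hα hD)
  rw [h2, hmat_genericZ]
  refine isLeading_det (wt K) (fun r c : Fin D => entryCoeff α 0 r c)
    (fun r c : Fin D => entryMono α r c) 1 h1 fun σ hσ hσ' => wt_sum_lt K hσ' h1 ?_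
  exact sum_perm_mul_lt_of_strictMono (B := fun c : Fin D => slope α K c)
    (fun a b hab => slope_lt_slope hK hab) hσ

theorem det_hmat_genericZ_zero {α : Fin N → Finset ℕ} {D : ℕ} (hD : (columns α).length ≤ D) :
    (hmat α D (genericZ N 0)).det = (Delta0 α).det :=
  det_hmat_eq_det_Delta0 hD (fun _ => rfl) fun _ _ => rfl

theorem isLeading_det_Delta0 {α : Fin N → Finset ℕ} (hα : α ∈ BPlus N) {K : ℕ}
    (hK : ∀ q ∈ columns α, q.2 < K) :
    IsLeading (wt K) (Delta0 α).det (mono (columns α)) := by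
  rw [← det_hmat_genericZ_zero (length_columns_le hα hK)]
  exact isLeading_det_hmat_genericZ_zero hα hK hK

theorem linearIndependent_det_Delta0 (N d : ℕ) (hd : 1 ≤ d) :
    LinearIndependent ℂ fun α : {α : Fin N → Finset ℕ // α ∈ BPlus N ∧ maxTerm α ≤ d - 1} =>
      (Delta0 α.1).det := by
  refine linearIndependent_of_isLeading (wt d) _ (fun α => mono (columns α.1)) ?_ fun α =>
    isLeading_det_Delta0 α.2.1 fun q hq => ?_
  · intro α β h
    exact Subtype.ext (mono_columns_injOn α.2.1 β.2.1 h)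
  · have := maxTerm_le_iff.1 α.2.2 q hq
    omega

/-! ### The determinants span the space of polynomials -/

/-- Both numbers are the same for all permutations: the determinants are bihomogeneous, which keeps
the triangular induction for the span inside a fixed degree and weight. -/
theorem degree_and_weight_of_mem_support {α : Fin N → Finset ℕ} {D : ℕ} {m : Fin N × ℕ →₀ ℕ}
    (hm : m ∈ (hmat α D (genericZ N 0)).det.support) :
    m.degree = ∑ c : Fin D, (if c.val < (columns α).length then 1 else 0) ∧
      (Finsupp.weight (fun q : Fin N × ℕ => q.2) m : ℕ) + ∑ c : Fin D, c.val =
        ∑ c : Fin D, (extCol α c).2 := by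
  rw [hmat_genericZ] at hm
  obtain ⟨σ, hσ, rfl⟩ := exists_perm_of_mem_support_det
    (fun r c : Fin D => entryCoeff α 0 r c) (fun r c : Fin D => entryMono α r c) hm
  constructor
  · rw [map_sum]
    refine Finset.sum_congr rfl fun c _ => ?_
    unfold entryMono
    split_ifs
    · exact Finsupp.degree_single _ _
    · simp
  · rw [map_sum, ← Equiv.sum_comp σ fun c : Fin D => c.val, ← Finset.sum_add_distrib]
    refine Finset.sum_congr rfl fun c _ => ?_
    have h := entryCoeff_ne_zero.1 (hσ c)
    unfold entryMono
    split_ifs with hc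
    · rw [Finsupp.weight_single, one_smul]
      simp only [extCol, dif_pos hc] at h ⊢
      omega
    · simp only [extCol, dif_neg hc, map_zero] at h ⊢
      have := h.1.resolve_left hc
      omega

theorem wt_le (K : ℕ) (m : Fin N × ℕ →₀ ℕ) :
    wt K m ≤ (Finsupp.weight (fun q : Fin N × ℕ => q.2) m : ℕ) ^ 2 := by
  set w := Finsupp.weight (fun q : Fin N × ℕ => q.2) m with hw
  have h1 : (w : ℤ) = ∑ q ∈ m.support, (m q : ℤ) * q.2 := by
    rw [hw, Finsupp.weight_apply, Finsupp.sum]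
    push_cast
    simp
  rw [sq]
  nth_rewrite 1 [h1]
  rw [wt, Finsupp.weight_apply, Finsupp.sum, Finset.sum_mul]
  refine Finset.sum_le_sum fun q hq => ?_
  have h2 : q.2 ≤ w :=
    Finsupp.le_weight_of_ne_zero' (fun q : Fin N × ℕ => q.2) (Finsupp.mem_support_iff.1 hq)
  have h3 : (q.2 : ℤ) ≤ w := by exact_mod_cast h2
  have h4 : (0 : ℤ) ≤ 2 * K * (q.1.val + 1) * q.2 := by positivity
  have h5 : (0 : ℤ) ≤ m q := Int.natCast_nonneg _
  rw [nsmul_eq_mul, mul_assoc (m q : ℤ)]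
  refine mul_le_mul_of_nonneg_left ?_ h5
  nlinarith [Int.natCast_nonneg q.2]

/-- A term is at most its reduced order plus its position, so one K serves all the α whose diagonal
monomials have given degree and weight. -/
theorem snd_lt_of_mono {α : Fin N → Finset ℕ} :
    ∀ q ∈ columns α, q.2 < (Finsupp.weight (fun q : Fin N × ℕ => q.2) (mono (columns α)) : ℕ) +
      (mono (columns α)).degree + 1 := by
  intro q hq
  obtain ⟨c, hc, rfl⟩ := List.getElem_of_mem hq
  have h1 : (mono (columns α)).degree = (columns α).length := by
    rw [mono_eq_sum, map_sum]
    simp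
  have h2 : mono (columns α) ((columns α)[c].1, (columns α)[c].2 - c) ≠ 0 := by
    rw [mono_eq_sum, Finsupp.finsetSum_apply]
    refine (Finset.sum_pos' (fun _ _ => Nat.zero_le _) ⟨⟨c, hc⟩, Finset.mem_univ _, ?_⟩).ne'
    simp
  have h3 := Finsupp.le_weight_of_ne_zero' (fun q : Fin N × ℕ => q.2) h2
  dsimp only at h3
  omega

/-- The determinant with diagonal monomial m expresses m through monomials of larger `wt` and the
same degree and weight; `wt` is at most w² (`wt_le`), so the gap k to this bound serves for the
induction. -/
theorem monomial_mem_span_det_Delta0 (n w : ℕ) : ∀ (k : ℕ) (m : Fin N × ℕ →₀ ℕ),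
    m.degree = n → Finsupp.weight (fun q : Fin N × ℕ => q.2) m = w →
    (w : ℤ) ^ 2 - wt (w + n + 1) m < k →
    MvPolynomial.monomial m (1 : ℂ) ∈
      Submodule.span ℂ ((fun α : Fin N → Finset ℕ => (Delta0 α).det) '' BPlus N) := by
  classical
  intro k
  induction k with
  | zero =>
    intro m _ hw h
    have := wt_le (w + n + 1) m
    rw [hw] at this
    push_cast at h
    omega
  | succ k ih =>
    intro m hn hw hk
    obtain ⟨α, hα, rfl⟩ := exists_mono_columns_eq m
    have hK : ∀ q ∈ columns α, q.2 < w + n + 1 := by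
      have := snd_lt_of_mono (α := α)
      rwa [hn, hw] at this
    have hlead := isLeading_det_Delta0 hα hK
    have hlen := length_columns_le hα hK
    have hmem : (Delta0 α).det ∈
        Submodule.span ℂ ((fun α : Fin N → Finset ℕ => (Delta0 α).det) '' BPlus N) :=
      Submodule.subset_span ⟨α, hα, rfl⟩
    set μ := mono (columns α) with hμ
    set f := (Delta0 α).det with hf
    have hμs : μ ∈ f.support := MvPolynomial.mem_support_iff.2 hlead.1
    have hdw : ∀ m ∈ f.support, m.degree = n ∧
        Finsupp.weight (fun q : Fin N × ℕ => q.2) m = w := by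
      intro m hm
      rw [hf, ← det_hmat_genericZ_zero hlen] at hm hμs
      have h1 := degree_and_weight_of_mem_support hm
      have h2 := degree_and_weight_of_mem_support hμs
      rw [h1.1, ← h2.1]
      refine ⟨hn, ?_⟩
      rw [← hw]
      omega
    have hsum := f.as_sum
    rw [← Finset.add_sum_erase _ _ hμs] at hsum
    have h3 : MvPolynomial.monomial μ (MvPolynomial.coeff μ f) ∈
        Submodule.span ℂ ((fun α : Fin N → Finset ℕ => (Delta0 α).det) '' BPlus N) := by
      rw [← sub_eq_iff_eq_add] at hsum
      rw [← hsum]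
      refine Submodule.sub_mem _ hmem (Submodule.sum_mem _ fun m hm => ?_)
      rw [Finset.mem_erase] at hm
      have h4 := hlead.2 m hm.2 hm.1
      have h5 := ih m (hdw m hm.2).1 (hdw m hm.2).2 (by push_cast at hk; omega)
      have h6 := Submodule.smul_mem _ (MvPolynomial.coeff m f) h5
      rwa [MvPolynomial.smul_monomial, smul_eq_mul, mul_one] at h6
    have h4 := Submodule.smul_mem _ (MvPolynomial.coeff μ f)⁻¹ h3
    rwa [MvPolynomial.smul_monomial, smul_eq_mul, inv_mul_cancel₀ hlead.1] at h4

theorem span_det_Delta0 (N : ℕ) :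
    Submodule.span ℂ ((fun α : Fin N → Finset ℕ => (Delta0 α).det) '' BPlus N) = ⊤ := by
  rw [eq_top_iff]
  intro P _
  rw [P.as_sum]
  refine Submodule.sum_mem _ fun m _ => ?_
  have h := Submodule.smul_mem _ (MvPolynomial.coeff m P)
    (monomial_mem_span_det_Delta0 _ _
      (((Finsupp.weight (fun q : Fin N × ℕ => q.2) m : ℕ) : ℤ) ^ 2 -
        wt (Finsupp.weight (fun q : Fin N × ℕ => q.2) m + m.degree + 1) m + 1).toNat m rfl rfl
      (by
        have := Int.self_le_toNat (((Finsupp.weight (fun q : Fin N × ℕ => q.2) m : ℕ) : ℤ) ^ 2 -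
          wt (Finsupp.weight (fun q : Fin N × ℕ => q.2) m + m.degree + 1) m + 1)
        omega))
  rwa [MvPolynomial.smul_monomial, smul_eq_mul, mul_one] at h

/-! ### The determinants at a point of the hyperplane at infinity -/

/-- The leading monomial of the determinant for `genericZ N 1`, when `c₀` is the position of the
last column with the largest second component. -/
noncomputable def infMono (L : List (Fin N × ℕ)) (c₀ : ℕ) (h : c₀ < L.length) :
    Fin N × ℕ →₀ ℕ :=
  Finsupp.single ((L[c₀]).1, 0) 1 + mono (L.eraseIdx c₀)

/-- Column c₀, whose term is D, meets line D in an underived variable; the other columns use the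
diagonal of the list with c₀ erased. -/
theorem sum_entryMono_toLast {α : Fin N → Finset ℕ} {D : ℕ} (hlen : (columns α).length ≤ D + 1)
    (c₀ : Fin (D + 1)) (hc₀ : c₀.val < (columns α).length) (ha : ((columns α)[c₀.val]).2 = D) :
    ∑ c, entryMono α (toLast c₀ c) c = infMono (columns α) c₀ hc₀ := by
  have hlen' : ((columns α).eraseIdx c₀.val).length = (columns α).length - 1 :=
    List.length_eraseIdx_of_lt hc₀
  rw [Fin.sum_univ_succAbove _ c₀, infMono, mono_eq_sum_fin (D := D) _ (by omega)]
  congr 1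
  · simp [entryMono, hc₀, ha]
  · refine Finset.sum_congr rfl fun i _ => ?_
    rw [toLast_succAbove, entryMono]
    have hval : (c₀.succAbove i).val = if i.val < c₀.val then i.val else i.val + 1 := by
      rw [Fin.succAbove]
      split_ifs with h1 h2 h2
      · rfl
      · exact absurd h1 h2
      · exact absurd h2 h1
      · rfl
    by_cases h : i.val < (columns α).length - 1
    · have hi : i.val < ((columns α).eraseIdx c₀.val).length := by omega
      have hi' : (c₀.succAbove i).val < (columns α).length := by
        rw [hval]; split_ifs <;> omega
      simp only [dif_pos hi, dif_pos hi']
      simp only [hval, Fin.val_castSucc, List.getElem_eraseIdx]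
      split_ifs <;> rfl
    · rw [dif_neg (show ¬ (c₀.succAbove i).val < (columns α).length by
          rw [hval]; split_ifs <;> omega),
        dif_neg (show ¬ i.val < ((columns α).eraseIdx c₀.val).length by omega)]

/-- When X_0 = t, an added column c is nonzero only on line c - 1, so the last line must be taken by
a column with term D, at a position at most c₀. Then `sum_perm_mul_lt_of_le` applies. -/
theorem isLeading_det_hmat_genericZ_one {α : Fin N → Finset ℕ} (hα : α ∈ BPlus N) {D : ℕ}
    (hD : ∀ q ∈ columns α, q.2 < D + 1) (c₀ : ℕ) (hc₀ : c₀ < (columns α).length)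
    (ha : ((columns α)[c₀]).2 = D)
    (hmax : ∀ c (hc : c < (columns α).length), ((columns α)[c]).2 = D → c ≤ c₀) :
    IsLeading (wt (D + 1)) (hmat α (D + 1) (genericZ N 1)).det (infMono (columns α) c₀ hc₀) := by
  have hlen := length_columns_le hα hD
  have hρ : ∀ c : Fin (D + 1),
      entryCoeff α 1 (toLast (⟨c₀, by omega⟩ : Fin (D + 1)) c) c ≠ 0 := by
    intro c
    rw [entryCoeff_ne_zero]
    induction c using Fin.succAboveCases (⟨c₀, by omega⟩ : Fin (D + 1)) with
    | x => simp [hc₀, ha, extCol]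
    | p i =>
      rw [toLast_succAbove]
      have h1 := le_extCol_snd hα ((⟨c₀, by omega⟩ : Fin (D + 1)).succAbove i)
      refine ⟨?_, le_trans ?_ h1⟩
      · rw [Fin.succAbove]
        split_ifs with h
        · left
          rw [Fin.lt_def] at h
          exact lt_trans h hc₀
        · right
          simp
      · rw [Fin.succAbove]
        split_ifs with h <;> simp
  rw [← sum_entryMono_toLast hlen ⟨c₀, by omega⟩ hc₀ ha, hmat_genericZ]
  refine isLeading_det (wt (D + 1)) (fun r c : Fin (D + 1) => entryCoeff α 1 r c)
    (fun r c : Fin (D + 1) => entryMono α r c) _ hρ fun σ hσ hσ' => wt_sum_lt _ hσ' hρ ?_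
  obtain ⟨c₁, hc₁⟩ := σ.surjective (Fin.last D)
  refine sum_perm_mul_lt_of_le (B := fun c : Fin (D + 1) => slope α (D + 1) c)
    (fun a b hab => slope_lt_slope hD hab) hσ hc₁ ?_
  have h := entryCoeff_ne_zero.1 (hσ' c₁)
  rw [hc₁, Fin.val_last] at h
  by_cases hc : c₁.val < (columns α).length
  · refine hmax c₁ hc ?_
    have h2 := h.2
    simp only [extCol, dif_pos hc] at h2
    have := hD _ (List.getElem_mem hc)
    omega
  · have := h.1.resolve_left hc
    omega

/-- Columns before c₀ have at least the index of c₀; those after it move up one line, so their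
variables are derived at least once. Thus the index of c₀ is the least one of an underived variable,
and `infMono` determines it. -/
theorem le_of_infMono_ne_zero {L : List (Fin N × ℕ)} (hL : L.Pairwise ColLT)
    (hle : ∀ c (hc : c < L.length), c ≤ (L[c]).2) {c₀ : ℕ} (hc₀ : c₀ < L.length) {j : Fin N}
    (hj : infMono L c₀ hc₀ (j, 0) ≠ 0) : (L[c₀]).1 ≤ j := by
  by_contra hlt
  rw [infMono, Finsupp.add_apply, Finsupp.single_eq_of_ne, zero_add, mono_eq_sum,
    Finsupp.finsetSum_apply] at hj
  · obtain ⟨i, -, hi⟩ := Finset.exists_ne_zero_of_sum_ne_zero hj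
    rw [Finsupp.single_apply, ne_eq, ite_eq_right_iff, Classical.not_imp, Prod.mk.injEq] at hi
    obtain ⟨⟨h1, h2⟩, -⟩ := hi
    have hi2 : i.val < L.length - 1 := lt_of_lt_of_eq i.2 (List.length_eraseIdx_of_lt hc₀)
    rw [List.pairwise_iff_getElem] at hL
    simp only [Fin.getElem_fin, List.getElem_eraseIdx] at h1 h2
    by_cases hic : i.val < c₀
    · simp only [dif_pos hic] at h1 h2
      have := hL i.val c₀ (by omega) hc₀ hic
      unfold ColLT at this
      omega
    · simp only [dif_neg hic] at h1 h2
      have := hle (i.val + 1) (by omega)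
      omega
  · intro h
    rw [Prod.mk.injEq] at h
    exact hlt h.1.ge

theorem infMono_injOn {α β : Fin N → Finset ℕ} (hα : α ∈ BPlus N) (hβ : β ∈ BPlus N) {D a b : ℕ}
    (ha : a < (columns α).length) (hb : b < (columns β).length)
    (haD : ((columns α)[a]).2 = D) (hbD : ((columns β)[b]).2 = D)
    (h : infMono (columns α) a ha = infMono (columns β) b hb) : α = β := by
  have hself : ∀ (L : List (Fin N × ℕ)) (c : ℕ) (hc : c < L.length),
      infMono L c hc ((L[c]).1, 0) ≠ 0 := by
    intro L c hc
    simp [infMono]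
  have h1 : ((columns α)[a]).1 = ((columns β)[b]).1 := by
    apply le_antisymm
    · refine le_of_infMono_ne_zero (pairwise_columns α) (le_snd_columns hα) ha ?_
      rw [h]
      exact hself _ _ _
    · refine le_of_infMono_ne_zero (pairwise_columns β) (le_snd_columns hβ) hb ?_
      rw [← h]
      exact hself _ _ _
  have hers : ∀ (γ : Fin N → Finset ℕ) (_ : γ ∈ BPlus N) (c : ℕ) (hc : c < (columns γ).length),
      ∀ i (hi : i < ((columns γ).eraseIdx c).length), i ≤ (((columns γ).eraseIdx c)[i]).2 := by
    intro γ hγ c hc i hi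
    rw [List.length_eraseIdx_of_lt hc] at hi
    rw [List.getElem_eraseIdx]
    split_ifs
    · exact le_snd_columns hγ i _
    · exact (Nat.le_succ i).trans (le_snd_columns hγ (i + 1) (by omega))
  have h2 : (columns α).eraseIdx a = (columns β).eraseIdx b := by
    refine mono_injOn ((pairwise_columns α).sublist (List.eraseIdx_sublist _ _))
      ((pairwise_columns β).sublist (List.eraseIdx_sublist _ _)) (hers α hα a ha)
      (hers β hβ b hb) ?_
    rw [infMono, infMono, h1] at h
    exact add_left_cancel h
  have h3 : (columns α)[a] = (columns β)[b] := Prod.ext h1 (haD.trans hbD.symm)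
  apply columns_injective
  refine eq_of_pairwise_colLT (pairwise_columns α) (pairwise_columns β) fun q => ?_
  rw [← (List.getElem_cons_eraseIdx_perm ha).mem_iff, ← (List.getElem_cons_eraseIdx_perm hb).mem_iff,
    h2, h3]

theorem linearIndependent_det_hmat_genericZ_one (N D : ℕ) :
    LinearIndependent ℂ fun α : {α : Fin N → Finset ℕ // α ∈ BPlus N ∧
        (∀ q ∈ columns α, q.2 < D + 1) ∧ ∃ q ∈ columns α, q.2 = D} =>
      (hmat α.1 (D + 1) (genericZ N 1)).det := by
  have hex : ∀ α : {α : Fin N → Finset ℕ // α ∈ BPlus N ∧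
      (∀ q ∈ columns α, q.2 < D + 1) ∧ ∃ q ∈ columns α, q.2 = D},
      ∃ c₀, ∃ hc₀ : c₀ < (columns α.1).length, ((columns α.1)[c₀]).2 = D ∧
        ∀ c (hc : c < (columns α.1).length), ((columns α.1)[c]).2 = D → c ≤ c₀ := by
    rintro ⟨α, hα, h1, q, hq, hqD⟩
    obtain ⟨c, hc, rfl⟩ := List.getElem_of_mem hq
    obtain ⟨c₀, hc₀, hmax⟩ := (Finset.univ.filter fun c : Fin (columns α).length =>
      ((columns α)[c]).2 = D).exists_max_image (fun c => c.val) ⟨⟨c, hc⟩, by simpa using hqD⟩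
    refine ⟨c₀, c₀.2, (Finset.mem_filter.1 hc₀).2, fun c hc h => ?_⟩
    exact hmax ⟨c, hc⟩ (Finset.mem_filter.2 ⟨Finset.mem_univ _, h⟩)
  choose c₀ hc₀ hD hmax using hex
  refine linearIndependent_of_isLeading (wt (D + 1)) _
    (fun α => infMono (columns α.1) (c₀ α) (hc₀ α)) ?_ fun α =>
    isLeading_det_hmat_genericZ_one α.2.1 α.2.2.1 _ _ (hD α) (hmax α)
  intro α β h
  exact Subtype.ext (infMono_injOn α.2.1 β.2.1 (hc₀ α) (hc₀ β) (hD α) (hD β) h)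

end Weights

end GreenGriffiths

namespace GreenGriffiths

/-! ### Curves given by homogeneous coordinates -/

section Curves

variable {N k : ℕ}

theorem ratio_self {i : Fin (N + 1)} {p : PSpace N} (h : p ∈ chartDomain i) : ratio i i p = 1 :=
  div_self h

theorem ratio_mul_ratio {i j : Fin (N + 1)} (l : Fin (N + 1)) {p : PSpace N}
    (hj : p ∈ chartDomain j) : ratio i j p * ratio j l p = ratio i l p := by
  have hj' : p.rep j ≠ 0 := hj
  unfold ratio
  field_simp

theorem exists_curve (X : ℂ → Fin (N + 1) → ℂ) (hX : ∀ l, AnalyticAt ℂ (fun t => X t l) 0) :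
    ∃ γ : ℂ → PSpace N, ∀ i, X 0 i ≠ 0 → HolomorphicInChart i γ ∧
      ∀ᶠ t in nhds (0 : ℂ), ∀ l, ratio i l (γ t) = X t l / X t i := by
  classical
  -- The point chosen where X t = 0 is irrelevant: X t i ≠ 0 near t = 0.
  refine ⟨fun t => if h : X t = 0 then Projectivization.mk ℂ (fun _ => 1) (by
    intro h'
    exact one_ne_zero (congrFun h' 0)) else Projectivization.mk ℂ (X t) h, fun i hi => ?_⟩
  have hev : ∀ᶠ t in nhds (0 : ℂ), X t i ≠ 0 := (hX i).continuousAt.eventually_ne hi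
  have hne : ∀ t, X t i ≠ 0 → X t ≠ 0 := fun t h h' => h (congrFun h' i)
  have hrat : ∀ᶠ t in nhds (0 : ℂ), ∀ l, ratio i l (if h : X t = 0 then
      Projectivization.mk ℂ (fun _ => 1) (by
        intro h'
        exact one_ne_zero (congrFun h' 0)) else Projectivization.mk ℂ (X t) h) =
      X t l / X t i := by
    filter_upwards [hev] with t ht l
    rw [dif_neg (hne t ht), ratio_mk]
  refine ⟨⟨?_, ?_⟩, hrat⟩
  · filter_upwards [hev] with t ht
    rw [dif_neg (hne t ht), mk_mem_chartDomain]
    exact ht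
  · rw [analyticAt_pi_iff]
    intro a
    refine ((hX (i.succAbove a)).div (hX i) hi).congr ?_
    filter_upwards [hrat] with t ht
    exact (ht _).symm

/-- The jets in the chart of index `i` of the curve with homogeneous coordinates `X`. -/
noncomputable def homJet (i : Fin (N + 1)) (X : ℂ → Fin (N + 1) → ℂ) : Fin N × ℕ → ℂ :=
  fun v => iteratedDeriv v.2 (fun t => X t (i.succAbove v.1) / X t i) 0

/-- The value of a local section at a jet. -/
noncomputable def evalAt (f : (Fin N → ℂ) → JetPoly N k) (ξ : Fin N × ℕ → ℂ) : ℂ :=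
  MvPolynomial.eval (fun v => ξ (v.1, v.2.val + 1)) (f fun a => ξ (a, 0))

theorem evalAt_congr (f : (Fin N → ℂ) → JetPoly N k) {ξ η : Fin N × ℕ → ℂ}
    (h : ∀ a, ∀ l ≤ k, ξ (a, l) = η (a, l)) : evalAt f ξ = evalAt f η := by
  unfold evalAt
  have h1 : (fun a => ξ (a, 0)) = fun a => η (a, 0) := funext fun a => h a 0 (Nat.zero_le _)
  have h2 : (fun v : Fin N × Fin k => ξ (v.1, v.2.val + 1)) = fun v => η (v.1, v.2.val + 1) :=
    funext fun v => h v.1 _ v.2.2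
  rw [h1, h2]

theorem evalAt_homJet {d : ℕ} {s : LocalFamily N k} (hs : IsCompatible d s) (i j : Fin (N + 1))
    {X : ℂ → Fin (N + 1) → ℂ} (hX : ∀ l, AnalyticAt ℂ (fun t => X t l) 0) (hi : X 0 i ≠ 0)
    (hj : X 0 j ≠ 0) :
    evalAt (s i) (homJet i X) = (X 0 j / X 0 i) ^ d * evalAt (s j) (homJet j X) := by
  obtain ⟨γ, hγ⟩ := exists_curve X hX
  have key : ∀ i, X 0 i ≠ 0 →
      evalAt (s i) (homJet i X) = MvPolynomial.eval (jet k i γ) (s i (chart i (γ 0))) := by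
    intro i hi
    have hγi := (hγ i hi).2
    have h1 : (fun a => homJet i X (a, 0)) = chart i (γ 0) := by
      funext a
      simp only [homJet, iteratedDeriv_zero, chart]
      exact (hγi.self_of_nhds _).symm
    have h2 : (fun v : Fin N × Fin k => homJet i X (v.1, v.2.val + 1)) = jet k i γ := by
      funext v
      refine Filter.EventuallyEq.iteratedDeriv_eq _ ?_
      filter_upwards [hγi] with t ht
      exact (ht _).symm
    unfold evalAt
    rw [h1, h2]
  rw [key i hi, key j hj, hs i j γ (hγ i hi).1 (hγ j hj).1, (hγ i hi).2.self_of_nhds j]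

/-- A polynomial function with prescribed derivatives at `0` of the orders less than `n`. -/
noncomputable def polyOfJet (n : ℕ) (ξ : ℕ → ℂ) (t : ℂ) : ℂ :=
  ∑ l ∈ Finset.range n, ξ l / l.factorial * t ^ l

theorem analyticAt_polyOfJet (n : ℕ) (ξ : ℕ → ℂ) : AnalyticAt ℂ (polyOfJet n ξ) 0 := by
  unfold polyOfJet
  fun_prop

theorem iteratedDeriv_polyOfJet {n l : ℕ} (hl : l < n) (ξ : ℕ → ℂ) :
    iteratedDeriv l (polyOfJet n ξ) 0 = ξ l := by
  have h1 : polyOfJet n ξ = fun t => ∑ l ∈ Finset.range n, ξ l / l.factorial * t ^ l := rfl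
  rw [h1, iteratedDeriv_fun_sum fun i _ => by fun_prop, Finset.sum_eq_single_of_mem l
    (Finset.mem_range.2 hl)]
  · rw [iteratedDeriv_const_mul_field, iteratedDeriv_fun_pow_zero, if_pos rfl,
      div_mul_cancel₀ _ (Nat.cast_ne_zero.2 l.factorial_ne_zero)]
  · intro b _ hb
    rw [iteratedDeriv_const_mul_field, iteratedDeriv_fun_pow_zero, if_neg hb.symm, Nat.cast_zero,
      mul_zero]

@[simp] theorem polyOfJet_zero {n : ℕ} (hn : 0 < n) (ξ : ℕ → ℂ) : polyOfJet n ξ 0 = ξ 0 := by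
  simpa using iteratedDeriv_polyOfJet hn ξ

end Curves

/-! ### The sections attached to the determinants -/

section Sections

variable {N k : ℕ}

/-- The local section given by a polynomial, truncated to the order `k`. -/
noncomputable def famOf (k : ℕ) (P : E N) (x : Fin N → ℂ) : JetPoly N k :=
  MvPolynomial.aeval (fun q : Fin N × ℕ => if q.2 = 0 then MvPolynomial.C (x q.1) else
    if h : q.2 - 1 < k then MvPolynomial.X (q.1, ⟨q.2 - 1, h⟩) else 0) P

theorem evalAt_famOf (P : E N) (ξ : Fin N × ℕ → ℂ) :
    evalAt (famOf k P) ξ = MvPolynomial.eval (fun q => if q.2 ≤ k then ξ q else 0) P := by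
  unfold evalAt famOf
  rw [MvPolynomial.aeval_def, MvPolynomial.algebraMap_eq]
  induction P using MvPolynomial.induction_on with
  | C a => simp
  | add p q hp hq => simp only [map_add, MvPolynomial.eval₂_add, hp, hq]
  | mul_X p q hp =>
    simp only [map_mul, MvPolynomial.eval₂_mul, hp, MvPolynomial.eval₂_X, MvPolynomial.eval_X]
    congr 1
    obtain ⟨a, l⟩ := q
    rcases l with _ | l
    · simp
    · by_cases hl : l < k
      · simp [hl]
      · simp [hl]

theorem analyticOnNhd_coeff_famOf (P : E N) (m : Fin N × Fin k →₀ ℕ) :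
    AnalyticOnNhd ℂ (fun x => MvPolynomial.coeff m (famOf k P x)) Set.univ := by
  classical
  unfold famOf
  simp only [MvPolynomial.aeval_def, MvPolynomial.algebraMap_eq]
  induction P using MvPolynomial.induction_on generalizing m with
  | C a =>
    simp only [MvPolynomial.eval₂_C]
    exact analyticOnNhd_const
  | add p q hp hq =>
    simp only [MvPolynomial.eval₂_add, MvPolynomial.coeff_add]
    exact (hp m).add (hq m)
  | mul_X p q hp =>
    simp only [MvPolynomial.eval₂_mul, MvPolynomial.eval₂_X, MvPolynomial.coeff_mul]
    refine Finset.analyticOnNhd_fun_sum _ fun n _ => (hp n.1).mul ?_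
    split_ifs
    · simp only [MvPolynomial.coeff_C]
      split_ifs
      · exact (ContinuousLinearMap.proj (R := ℂ) (φ := fun _ : Fin N => ℂ) q.1).analyticOnNhd _
      · exact analyticOnNhd_const
    · exact analyticOnNhd_const
    · exact analyticOnNhd_const

/-- The derivatives of the homogeneous coordinates, when that of index `i` is `1` and the
other ones are generic. -/
noncomputable def chartZ (i : Fin (N + 1)) : Fin (N + 1) → ℕ → E N :=
  i.insertNth (α := fun _ => ℕ → E N) (fun l => if l = 0 then 1 else 0)
    fun a l => MvPolynomial.X (a, l)

@[simp] theorem chartZ_self (i : Fin (N + 1)) (l : ℕ) :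
    chartZ i i l = if l = 0 then 1 else 0 := by
  simp [chartZ]

@[simp] theorem chartZ_succAbove (i : Fin (N + 1)) (a : Fin N) (l : ℕ) :
    chartZ i (i.succAbove a) l = MvPolynomial.X (a, l) := by
  simp [chartZ]

theorem chartZ_zero : chartZ (0 : Fin (N + 1)) = genericZ N 0 := by
  funext j l
  induction j using Fin.cases with
  | zero => simp
  | succ j =>
    have := chartZ_succAbove (0 : Fin (N + 1)) j l
    rw [Fin.zero_succAbove] at this
    rw [this, genericZ_succ]

/-- The family of local sections attached to `α`. -/
noncomputable def detFamily (k d : ℕ) (α : Fin N → Finset ℕ) : LocalFamily N k :=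
  fun i => famOf k (hmat α d (chartZ i)).det

/-- Only derivatives of order less than d occur, so the truncation at order k loses nothing. -/
theorem evalAt_detFamily {d : ℕ} (hk : d - 1 ≤ k) {α : Fin N → Finset ℕ}
    (hD : ∀ q ∈ columns α, q.2 < d) (i : Fin (N + 1)) (ξ : Fin N × ℕ → ℂ) :
    evalAt (detFamily k d α i) ξ = MvPolynomial.eval ξ (hmat α d (chartZ i)).det := by
  rw [detFamily, evalAt_famOf, map_det_hmat, map_det_hmat]
  refine det_hmat_congr hD fun j l hl => ?_
  induction j using Fin.succAboveCases i with
  | x => simp only [chartZ_self]; split_ifs <;> simp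
  | p a => simp [show l ≤ k by omega]

theorem eval_det_hmat_chartZ {d : ℕ} {α : Fin N → Finset ℕ} (i : Fin (N + 1))
    (Z : Fin (N + 1) → ℕ → ℂ) (hZ : ∀ l, Z i l = if l = 0 then 1 else 0) :
    MvPolynomial.eval (fun q => Z (i.succAbove q.1) q.2) (hmat α d (chartZ i)).det =
      (hmat α d Z).det := by
  rw [map_det_hmat]
  congr 2
  funext j l
  induction j using Fin.succAboveCases i with
  | x => rw [chartZ_self, hZ]; split_ifs <;> simp
  | p a => simp

theorem analyticAt_ratio {i : Fin (N + 1)} {γ : ℂ → PSpace N} (h : HolomorphicInChart i γ)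
    (l : Fin (N + 1)) : AnalyticAt ℂ (fun t => ratio i l (γ t)) 0 := by
  induction l using Fin.succAboveCases i with
  | x =>
    refine (analyticAt_const (v := (1 : ℂ))).congr ?_
    filter_upwards [h.1] with t ht
    exact (ratio_self ht).symm
  | p a => exact (analyticAt_pi_iff.1 h.2) a

/-- The ratios X_l/X_i are homogeneous coordinates of the curve, and they are X_j/X_i times the
ratios X_l/X_j. -/
theorem isCompatible_detFamily {d : ℕ} (hk : d - 1 ≤ k) {α : Fin N → Finset ℕ}
    (hD : ∀ q ∈ columns α, q.2 < d) : IsCompatible d (detFamily k d α) := by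
  intro i j γ hi hj
  have key : ∀ i, HolomorphicInChart i γ →
      MvPolynomial.eval (jet k i γ) (detFamily k d α i (chart i (γ 0))) =
        (hmat α d fun l m => iteratedDeriv m (fun t => ratio i l (γ t)) 0).det := by
    intro i hi
    have h1 := evalAt_detFamily hk hD i
      fun q => iteratedDeriv q.2 (fun t => ratio i (i.succAbove q.1) (γ t)) 0
    rw [eval_det_hmat_chartZ (α := α) (d := d) i
      (fun l m => iteratedDeriv m (fun t => ratio i l (γ t)) 0)] at h1
    · rw [← h1, evalAt]
      simp only [iteratedDeriv_zero]
      rfl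
    · intro l
      have h2 : (fun t => ratio i i (γ t)) =ᶠ[nhds 0] fun _ => (1 : ℂ) := by
        filter_upwards [hi.1] with t ht
        exact ratio_self ht
      rw [h2.iteratedDeriv_eq, iteratedDeriv_const]
  rw [key i hi, key j hj]
  have h0 : ratio i j (γ 0) = iteratedDeriv 0 (fun t => ratio i j (γ t)) 0 := by
    rw [iteratedDeriv_zero]
  rw [h0]
  refine det_hmat_mul (u := fun m => iteratedDeriv m (fun t => ratio i j (γ t)) 0) hD
    fun l m _ => ?_
  have h1 : (fun t => ratio i l (γ t)) =ᶠ[nhds 0]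
      fun t => ratio i j (γ t) * ratio j l (γ t) := by
    filter_upwards [hj.1] with t ht
    exact (ratio_mul_ratio l ht).symm
  rw [h1.iteratedDeriv_eq]
  exact iteratedDeriv_fun_mul (analyticAt_ratio hi j).contDiffAt
    (analyticAt_ratio hj l).contDiffAt

theorem detFamily_mem_H0 {d : ℕ} (hk : d - 1 ≤ k) {α : Fin N → Finset ℕ}
    (hD : ∀ q ∈ columns α, q.2 < d) : detFamily k d α ∈ H0 N k d :=
  ⟨fun _ _ => by rw [fibreInf_eq_top]; exact Submodule.mem_top,
    fun _ m => analyticOnNhd_coeff_famOf _ m, isCompatible_detFamily hk hD⟩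

theorem isGivenBy_detFamily_zero {d : ℕ} (hk : d - 1 ≤ k) {α : Fin N → Finset ℕ}
    (hα : α ∈ BPlus N) (hD : ∀ q ∈ columns α, q.2 < d) :
    IsGivenBy (detFamily k d α 0) (Delta0 α).det := by
  intro ξ
  rw [← det_hmat_genericZ_zero (length_columns_le hα hD), ← chartZ_zero]
  exact evalAt_detFamily hk hD 0 ξ

end Sections

end GreenGriffiths

namespace GreenGriffiths

/-! ### Entire functions -/

section Entire

theorem countable_zeros {g : ℂ → ℂ} (hg : AnalyticOnNhd ℂ g Set.univ) (h : ∃ w, g w ≠ 0) :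
    {w | g w = 0}.Countable := by
  have h1 : {w | g w = 0}ᶜ ∈ Filter.codiscrete ℂ := by
    rcases hg.eqOn_zero_or_eventually_ne_zero_of_preconnected isPreconnected_univ with h0 | h0
    · obtain ⟨w, hw⟩ := h
      exact absurd (h0 (Set.mem_univ w)) hw
    · exact h0
  have h2 : IsDiscrete {w | g w = 0} := by simpa using (mem_codiscrete'.mp h1).2
  have := h2.to_subtype
  exact Set.countable_coe_iff.1 (countable_of_Lindelof_of_discrete)

/-- Countably many entire functions of which only finitely many are nonzero at each point: only
finitely many of them are not identically zero. -/
theorem finite_ne_zero_of_forall_finite {ι : Type*} [Countable ι] {g : ι → ℂ → ℂ}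
    (hg : ∀ m, AnalyticOnNhd ℂ (g m) Set.univ) (hfin : ∀ w, {m | g m w ≠ 0}.Finite) :
    {m | ∃ w, g m w ≠ 0}.Finite := by
  by_contra hinf
  -- A point outside this countable set is a zero of none of the functions that are not identically
  -- zero.
  have h1 : (⋃ m ∈ {m | ∃ w, g m w ≠ 0}, {w | g m w = 0}).Countable :=
    (Set.to_countable _).biUnion fun m hm => countable_zeros (hg m) hm
  obtain ⟨w, hw⟩ : ∃ w, w ∉ ⋃ m ∈ {m | ∃ w, g m w ≠ 0}, {w | g m w = 0} := by
    by_contra! hall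
    exact not_countable_complex (h1.mono fun w _ => hall w)
  refine hinf ((hfin w).subset fun m hm => ?_)
  simp only [Set.mem_iUnion, not_exists] at hw
  exact hw m hm

/-- Cauchy's estimate on a circle of radius R tending to infinity. -/
theorem iteratedDeriv_eq_zero_of_growth {f : ℂ → ℂ} (hf : Differentiable ℂ f) {C : ℝ} {d n : ℕ}
    (hC : ∀ c, 1 ≤ ‖c‖ → ‖f c‖ ≤ C * ‖c‖ ^ d) (hn : d < n) : iteratedDeriv n f 0 = 0 := by
  have hC0 : 0 ≤ C := by
    have := hC 1 (by simp)
    simp only [norm_one, one_pow, mul_one] at this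
    exact (norm_nonneg _).trans this
  have h1 : ∀ R : ℝ, 1 ≤ R → ‖iteratedDeriv n f 0‖ ≤ n.factorial * C * R⁻¹ := by
    intro R hR
    have hR0 : 0 < R := by linarith
    have h2 := Complex.norm_iteratedDeriv_le_of_forall_mem_sphere_norm_le (c := 0) (R := R)
      (C := C * R ^ d) n hR0 hf.diffContOnCl fun z hz => by
        have hz' : ‖z‖ = R := by simpa using hz
        have := hC z (by rw [hz']; exact hR)
        rwa [hz'] at this
    refine h2.trans ?_
    rw [div_eq_mul_inv, mul_assoc, mul_assoc, mul_assoc]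
    have h3 : R ^ d * (R ^ n)⁻¹ ≤ R⁻¹ := by
      rw [← div_eq_mul_inv, div_le_iff₀ (by positivity), inv_mul_eq_div, le_div_iff₀ hR0,
        ← pow_succ]
      exact pow_le_pow_right₀ hR hn
    gcongr
  have h2 : Filter.Tendsto (fun R : ℝ => n.factorial * C * R⁻¹) Filter.atTop (nhds 0) := by
    simpa using (tendsto_inv_atTop_zero (𝕜 := ℝ)).const_mul (n.factorial * C)
  have h3 : ‖iteratedDeriv n f 0‖ ≤ 0 :=
    ge_of_tendsto h2 ((Filter.eventually_ge_atTop 1).mono h1)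
  exact norm_le_zero_iff.1 h3

theorem iteratedDeriv_eq_zero_of_eq_pow_mul {f h : ℂ → ℂ} (hf : Differentiable ℂ f)
    (hh : Continuous h) {d n : ℕ} (he : ∀ c, c ≠ 0 → f c = c ^ d * h c⁻¹) (hn : d < n) :
    iteratedDeriv n f 0 = 0 := by
  obtain ⟨M, hM⟩ := (isCompact_closedBall (0 : ℂ) 1).exists_bound_of_continuousOn hh.continuousOn
  refine iteratedDeriv_eq_zero_of_growth hf (C := M) (d := d) (fun c hc => ?_) hn
  have hc0 : c ≠ 0 := norm_pos_iff.1 (by linarith)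
  rw [he c hc0, norm_mul, norm_pow, mul_comm]
  refine mul_le_mul_of_nonneg_right (hM _ ?_) (by positivity)
  rw [mem_closedBall_zero_iff, norm_inv]
  exact inv_le_one_of_one_le₀ hc

theorem iteratedDeriv_mul_pow_zero {h : ℂ → ℂ} (hh : Differentiable ℂ h) (q e : ℕ) :
    iteratedDeriv (q + e) (fun c => h c * c ^ e) 0 =
      ((q + e).choose q * e.factorial : ℕ) * iteratedDeriv q h 0 := by
  rw [iteratedDeriv_fun_mul hh.contDiff.contDiffAt (by fun_prop),
    Finset.sum_eq_single_of_mem q (Finset.mem_range.2 (by omega))]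
  · rw [Nat.add_sub_cancel_left, iteratedDeriv_fun_pow_zero, if_pos rfl]
    push_cast
    ring
  · intro b hb hbq
    rw [Finset.mem_range] at hb
    rw [iteratedDeriv_fun_pow_zero, if_neg (by omega), Nat.cast_zero, mul_zero]

theorem eq_sum_of_iteratedDeriv_eq_zero {h : ℂ → ℂ} (hh : Differentiable ℂ h) {d : ℕ}
    (h0 : ∀ q, d < q → iteratedDeriv q h 0 = 0) :
    h 1 = ∑ q ∈ Finset.range (d + 1), (q.factorial : ℂ)⁻¹ * iteratedDeriv q h 0 := by
  have := Complex.taylorSeries_eq_of_entire' 0 1 hh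
  simp only [sub_zero, one_pow, mul_one] at this
  rw [← this]
  refine tsum_eq_sum fun q hq => ?_
  rw [h0 q (by simpa using hq), mul_zero]

theorem exists_eval_eq_multilinear {N q : ℕ}
    (T : ContinuousMultilinearMap ℂ (fun _ : Fin q => Fin N → ℂ) ℂ) :
    ∃ Q : MvPolynomial (Fin N) ℂ, ∀ x, T (fun _ => x) = MvPolynomial.eval x Q := by
  classical
  refine ⟨∑ r : Fin q → Fin N, MvPolynomial.C (T fun i => Pi.single (r i) 1) *
    ∏ i, MvPolynomial.X (r i), fun x => ?_⟩
  have h1 : (fun _ : Fin q => x) = fun _ => ∑ a, x a • (Pi.single a 1 : Fin N → ℂ) := by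
    funext _
    exact pi_eq_sum_univ' x
  rw [h1, T.map_sum, map_sum]
  refine Finset.sum_congr rfl fun r _ => ?_
  rw [T.map_smul_univ]
  simp [mul_comm]

end Entire

/-! ### Holomorphic sections are polynomial -/

section Polynomial

variable {N k : ℕ}

theorem evalAt_eq_sum {f : (Fin N → ℂ) → JetPoly N k} {x : Fin N → ℂ}
    {S : Finset (Fin N × Fin k →₀ ℕ)} (hS : ∀ m ∉ S, MvPolynomial.coeff m (f x) = 0)
    (y : Fin N × Fin k → ℂ) :
    MvPolynomial.eval y (f x) = ∑ m ∈ S, MvPolynomial.coeff m (f x) * ∏ v, y v ^ m v := by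
  rw [MvPolynomial.eval_eq']
  refine Finset.sum_subset (fun m hm => ?_) fun m _ hm => ?_
  · by_contra h
    exact MvPolynomial.mem_support_iff.1 hm (hS m h)
  · rw [MvPolynomial.notMem_support_iff.1 hm, zero_mul]

theorem differentiable_coeff_line {f : (Fin N → ℂ) → JetPoly N k}
    (hf : ∀ m, AnalyticOnNhd ℂ (fun x => MvPolynomial.coeff m (f x)) Set.univ)
    (x₀ x₁ : Fin N → ℂ) (m : Fin N × Fin k →₀ ℕ) :
    Differentiable ℂ fun w : ℂ => MvPolynomial.coeff m (f (x₀ + w • x₁)) := by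
  have h1 : Differentiable ℂ fun x => MvPolynomial.coeff m (f x) := fun x =>
    (hf m x (Set.mem_univ _)).differentiableAt
  exact h1.comp (by fun_prop : Differentiable ℂ fun w : ℂ => x₀ + w • x₁)

/-- The degree of the jet polynomial is not assumed bounded as the point varies; on a line only
finitely many coefficients are not identically zero. -/
theorem exists_finset_coeff_line {f : (Fin N → ℂ) → JetPoly N k}
    (hf : ∀ m, AnalyticOnNhd ℂ (fun x => MvPolynomial.coeff m (f x)) Set.univ)
    (x₀ x₁ : Fin N → ℂ) :
    ∃ S : Finset (Fin N × Fin k →₀ ℕ), ∀ (w : ℂ), ∀ m ∉ S,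
      MvPolynomial.coeff m (f (x₀ + w • x₁)) = 0 := by
  have h1 := finite_ne_zero_of_forall_finite
    (g := fun m (w : ℂ) => MvPolynomial.coeff m (f (x₀ + w • x₁)))
    (fun m w _ => (differentiable_coeff_line hf x₀ x₁ m).analyticAt w)
    fun w => by
      refine (f (x₀ + w • x₁)).support.finite_toSet.subset fun m hm => ?_
      exact MvPolynomial.mem_support_iff.2 hm
  refine ⟨h1.toFinset, fun w m hm => ?_⟩
  by_contra hne
  exact hm (h1.mem_toFinset.2 ⟨w, hne⟩)

theorem differentiable_evalAt_line {f : (Fin N → ℂ) → JetPoly N k}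
    (hf : ∀ m, AnalyticOnNhd ℂ (fun x => MvPolynomial.coeff m (f x)) Set.univ)
    (η₀ η₁ : Fin N × ℕ → ℂ) : Differentiable ℂ fun w : ℂ => evalAt f (η₀ + w • η₁) := by
  obtain ⟨S, hS⟩ := exists_finset_coeff_line hf (fun a => η₀ (a, 0)) fun a => η₁ (a, 0)
  have h1 : (fun w : ℂ => evalAt f (η₀ + w • η₁)) = fun w : ℂ => ∑ m ∈ S,
      MvPolynomial.coeff m (f ((fun a => η₀ (a, 0)) + w • fun a => η₁ (a, 0))) *
        ∏ v : Fin N × Fin k, (η₀ (v.1, v.2.val + 1) + w * η₁ (v.1, v.2.val + 1)) ^ m v := by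
    funext w
    exact evalAt_eq_sum (hS w) _
  rw [h1]
  refine Differentiable.fun_sum fun m _ => ?_
  refine (differentiable_coeff_line hf _ _ m).mul ?_
  fun_prop

/-- The homogeneous coordinates of the curve with coordinates `c x_a` in the chart `i`, where the
derivatives of `x_a` are prescribed by `ξ`. -/
noncomputable def scaledCurve (k : ℕ) (i : Fin (N + 1)) (ξ : Fin N × ℕ → ℂ) (c t : ℂ) :
    Fin (N + 1) → ℂ :=
  i.insertNth (α := fun _ => ℂ) 1 fun a => c * polyOfJet (k + 1) (fun l => ξ (a, l)) t

@[simp] theorem scaledCurve_self (i : Fin (N + 1)) (ξ : Fin N × ℕ → ℂ) (c t : ℂ) :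
    scaledCurve k i ξ c t i = 1 := by
  simp [scaledCurve]

@[simp] theorem scaledCurve_succAbove (i : Fin (N + 1)) (ξ : Fin N × ℕ → ℂ) (c t : ℂ)
    (b : Fin N) : scaledCurve k i ξ c t (i.succAbove b) =
      c * polyOfJet (k + 1) (fun l => ξ (b, l)) t := by
  simp [scaledCurve]

theorem analyticAt_scaledCurve (i : Fin (N + 1)) (ξ : Fin N × ℕ → ℂ) (c : ℂ) (l : Fin (N + 1)) :
    AnalyticAt ℂ (fun t => scaledCurve k i ξ c t l) 0 := by
  induction l using Fin.succAboveCases i with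
  | x =>
    simp only [scaledCurve_self]
    exact analyticAt_const
  | p b =>
    simp only [scaledCurve_succAbove]
    exact analyticAt_const.mul (analyticAt_polyOfJet _ _)

theorem evalAt_homJet_scaledCurve (f : (Fin N → ℂ) → JetPoly N k) (i : Fin (N + 1))
    (ξ : Fin N × ℕ → ℂ) (c : ℂ) :
    evalAt f (homJet i (scaledCurve k i ξ c)) = evalAt f (c • ξ) := by
  refine evalAt_congr _ fun b l hl => ?_
  simp only [homJet, scaledCurve_self, scaledCurve_succAbove, div_one, Pi.smul_apply, smul_eq_mul]
  rw [iteratedDeriv_const_mul_field, iteratedDeriv_polyOfJet (Nat.lt_succ_of_le hl)]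

theorem iteratedDeriv_evalAt_smul_eq_zero {d : ℕ} {s : LocalFamily N k} (hs : s ∈ H0 N k d)
    (i : Fin (N + 1)) {ξ : Fin N × ℕ → ℂ} {a : Fin N} (ha : ξ (a, 0) ≠ 0) {n : ℕ} (hn : d < n) :
    iteratedDeriv n (fun c : ℂ => evalAt (s i) (c • ξ)) 0 = 0 := by
  classical
  obtain ⟨-, hhol, hcomp⟩ := hs
  set j := i.succAbove a with hj
  set η := homJet j (scaledCurve k i ξ 1) with hη
  -- In the chart j, the dilation by c fixes the ratios x_b/x_a and multiplies 1/x_a by c⁻¹.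
  set η₀ : Fin N × ℕ → ℂ := fun q => if j.succAbove q.1 = i then 0 else η q with hη₀
  set η₁ : Fin N × ℕ → ℂ := fun q => if j.succAbove q.1 = i then η q else 0 with hη₁
  have hXi : ∀ c t, scaledCurve k i ξ c t i = 1 := scaledCurve_self i ξ
  have hXs : ∀ c t b, scaledCurve k i ξ c t (i.succAbove b) =
      c * polyOfJet (k + 1) (fun l => ξ (b, l)) t := scaledCurve_succAbove i ξ
  have hXj : ∀ c, scaledCurve k i ξ c 0 j = c * ξ (a, 0) := by
    intro c
    rw [hj, hXs, polyOfJet_zero (Nat.succ_pos k)]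
  have hright : ∀ c, c ≠ 0 → homJet j (scaledCurve k i ξ c) = η₀ + c⁻¹ • η₁ := by
    intro c hc
    funext q
    simp only [hη₀, hη₁, hη, homJet, Pi.add_apply, Pi.smul_apply, smul_eq_mul]
    split_ifs with h
    · rw [h, zero_add, ← iteratedDeriv_const_mul_field]
      congr 1
      funext t
      rw [hXi, hXi, hj, hXs, hXs, one_mul]
      simp [mul_comm]
    · obtain ⟨b, hb⟩ := Fin.exists_succAbove_eq h
      rw [mul_zero, add_zero]
      congr 1
      funext t
      rw [← hb, hj, hXs, hXs, hXs, hXs, one_mul, one_mul, mul_div_mul_left _ _ hc]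
  refine iteratedDeriv_eq_zero_of_eq_pow_mul (d := d)
    (h := fun w => ξ (a, 0) ^ d * evalAt (s j) (η₀ + w • η₁)) ?_ ?_ (fun c hc => ?_) hn
  · simpa using differentiable_evalAt_line (hhol i) 0 ξ
  · exact continuous_const.mul (differentiable_evalAt_line (hhol j) η₀ η₁).continuous
  · rw [← evalAt_homJet_scaledCurve, evalAt_homJet hcomp i j (analyticAt_scaledCurve i ξ c)
      (by rw [hXi]; exact one_ne_zero)
      (by rw [hXj]; exact mul_ne_zero hc ha), hright c hc, hXj, hXi, div_one, mul_pow, mul_assoc]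

/-- The dilation multiplies the jet monomial m by c^(deg m). The derivative of order q + deg m of
the section vanishes for every jet y, so each coefficient of this polynomial in y vanishes. -/
theorem iteratedDeriv_coeff_eq_zero {d : ℕ} {s : LocalFamily N k} (hs : s ∈ H0 N k d)
    (i : Fin (N + 1)) {x : Fin N → ℂ} (hx : x ≠ 0) (m : Fin N × Fin k →₀ ℕ) {q : ℕ}
    (hq : d < q + m.degree) :
    iteratedDeriv q (fun c : ℂ => MvPolynomial.coeff m (s i (c • x))) 0 = 0 := by
  have hhol := hs.2.1 i
  obtain ⟨a, ha⟩ := Function.ne_iff.1 hx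
  obtain ⟨S, hS⟩ := exists_finset_coeff_line hhol 0 x
  simp only [zero_add] at hS
  have hdiff : ∀ m, Differentiable ℂ fun c : ℂ => MvPolynomial.coeff m (s i (c • x)) := by
    intro m
    simpa using differentiable_coeff_line hhol 0 x m
  by_cases hm : m ∈ S
  · set n := q + m.degree with hn
    have h1 : ∀ y : Fin N × Fin k → ℂ, MvPolynomial.eval y (∑ m ∈ S, MvPolynomial.monomial m
        (iteratedDeriv n (fun c : ℂ => MvPolynomial.coeff m (s i (c • x)) * c ^ m.degree) 0)) =
          0 := by
      intro y
      let ξ : Fin N × ℕ → ℂ := fun v => if v.2 = 0 then x v.1 else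
        if h : v.2 - 1 < k then y (v.1, ⟨v.2 - 1, h⟩) else 0
      have h2 := iteratedDeriv_evalAt_smul_eq_zero hs i (ξ := ξ) (a := a) (by simpa [ξ] using ha) hq
      have h3 : (fun c : ℂ => evalAt (s i) (c • ξ)) = fun c : ℂ => ∑ m ∈ S,
          (MvPolynomial.coeff m (s i (c • x)) * c ^ m.degree) * ∏ v, y v ^ m v := by
        funext c
        have h4 : (fun a => (c • ξ) (a, 0)) = c • x := by
          funext a
          simp [ξ]
        have h5 : (fun v : Fin N × Fin k => (c • ξ) (v.1, v.2.val + 1)) = c • y := by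
          funext v
          simp [ξ]
        rw [evalAt, h4, h5, evalAt_eq_sum (hS c)]
        refine Finset.sum_congr rfl fun m _ => ?_
        simp only [Pi.smul_apply, smul_eq_mul, mul_pow]
        rw [Finset.prod_mul_distrib, Finset.prod_pow_eq_pow_sum, Finsupp.degree_eq_sum, mul_assoc]
      rw [h3, iteratedDeriv_fun_sum] at h2
      · rw [map_sum]
        refine Eq.trans ?_ h2
        refine Finset.sum_congr rfl fun m _ => ?_
        rw [MvPolynomial.eval_monomial, Finsupp.prod_fintype _ _ (by simp),
          iteratedDeriv_mul_const_field]
      · intro m _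
        have := hdiff m
        exact (((this.mul (by fun_prop)).mul_const _).contDiff).contDiffAt
    have h2 := MvPolynomial.funext (p := ∑ m ∈ S, MvPolynomial.monomial m
      (iteratedDeriv n (fun c : ℂ => MvPolynomial.coeff m (s i (c • x)) * c ^ m.degree) 0))
      (q := 0) fun y => by rw [h1, map_zero]
    have h3 := congrArg (MvPolynomial.coeff m) h2
    rw [MvPolynomial.coeff_sum, Finset.sum_eq_single_of_mem m hm, MvPolynomial.coeff_monomial,
      if_pos rfl, MvPolynomial.coeff_zero, hn, iteratedDeriv_mul_pow_zero (hdiff m)] at h3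
    · refine (mul_eq_zero.1 h3).resolve_left (Nat.cast_ne_zero.2 (mul_ne_zero ?_ ?_))
      · exact (Nat.choose_pos (Nat.le_add_right _ _)).ne'
      · exact Nat.factorial_ne_zero _
    · intro b _ hb
      rw [MvPolynomial.coeff_monomial, if_neg hb]
  · have : (fun c : ℂ => MvPolynomial.coeff m (s i (c • x))) = fun _ => 0 :=
      funext fun c => hS c m hm
    rw [this, iteratedDeriv_fun_const_zero]

/-- On each line through 0 the Taylor series stops at order d, and its terms are homogeneous
polynomials in x. -/
theorem exists_eval_eq_coeff {d : ℕ} {s : LocalFamily N k} (hs : s ∈ H0 N k d)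
    (i : Fin (N + 1)) (m : Fin N × Fin k →₀ ℕ) :
    ∃ Q : MvPolynomial (Fin N) ℂ, ∀ x, MvPolynomial.coeff m (s i x) = MvPolynomial.eval x Q := by
  have hhol := hs.2.1 i
  set f := fun x => MvPolynomial.coeff m (s i x) with hf
  choose Q hQ using fun q => exists_eval_eq_multilinear (iteratedFDeriv ℂ q f 0)
  refine ⟨∑ q ∈ Finset.range (d + 1), MvPolynomial.C (q.factorial : ℂ)⁻¹ * Q q, fun x => ?_⟩
  rw [map_sum]
  simp only [map_mul, MvPolynomial.eval_C, ← hQ]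
  by_cases hx : x = 0
  · subst hx
    rw [Finset.sum_eq_single_of_mem 0 (by simp)]
    · simp [hf]
    · intro q _ hq
      have : Nonempty (Fin q) := ⟨⟨0, Nat.pos_of_ne_zero hq⟩⟩
      rw [(iteratedFDeriv ℂ q f 0).map_coord_zero (Classical.arbitrary _) rfl, mul_zero]
  · have hdiff : Differentiable ℂ fun c : ℂ => f (c • x) := by
      simpa using differentiable_coeff_line hhol 0 x m
    have h1 := eq_sum_of_iteratedDeriv_eq_zero hdiff (d := d) fun q hq =>
      iteratedDeriv_coeff_eq_zero hs i hx m (by omega)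
    rw [one_smul] at h1
    refine h1.trans (Finset.sum_congr rfl fun q _ => ?_)
    congr 1
    have hfd : ContDiff ℂ ⊤ f := (hhol m).contDiff
    have h2 := (ContinuousLinearMap.toSpanSingleton ℂ x).iteratedFDeriv_comp_right
      (n := ⊤) hfd 0 (i := q) (by exact_mod_cast le_top)
    have h3 : (fun c : ℂ => f (c • x)) = f ∘ ContinuousLinearMap.toSpanSingleton ℂ x := by
      funext c
      simp
    rw [iteratedDeriv_eq_iteratedFDeriv, h3, h2]
    simp

theorem coeff_eq_zero_of_lt_degree {d : ℕ} {s : LocalFamily N k} (hs : s ∈ H0 N k d)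
    (i : Fin (N + 1)) (x : Fin N → ℂ) {m : Fin N × Fin k →₀ ℕ} (hm : d < m.degree) :
    MvPolynomial.coeff m (s i x) = 0 := by
  have key : ∀ x : Fin N → ℂ, x ≠ 0 → ∀ c : ℂ, MvPolynomial.coeff m (s i (c • x)) = 0 := by
    intro x hx c
    have hdiff : Differentiable ℂ fun c : ℂ => MvPolynomial.coeff m (s i (c • x)) := by
      simpa using differentiable_coeff_line (hs.2.1 i) 0 x m
    have h := Complex.taylorSeries_eq_of_entire' 0 c hdiff
    rw [← h]
    refine (tsum_congr fun q => ?_).trans tsum_zero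
    rw [iteratedDeriv_coeff_eq_zero hs i hx m (by omega), mul_zero, zero_mul]
  by_cases hx : x = 0
  -- As m ≠ 0 there is at least one affine coordinate, hence a line through the origin.
  · obtain ⟨v, hv⟩ : ∃ v, m v ≠ 0 := by
      by_contra! h
      have : m = 0 := Finsupp.ext h
      simp [this] at hm
    have h := key (fun _ => 1) (fun h => one_ne_zero (congrFun h v.1)) 0
    rwa [zero_smul, ← hx] at h
  · simpa using key x hx 1

/-- Every global holomorphic section is polynomial. -/
theorem isPolynomial_of_mem_H0 {d : ℕ} {s : LocalFamily N k} (hs : s ∈ H0 N k d) :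
    IsPolynomial s := by
  intro i
  choose Q hQ using exists_eval_eq_coeff hs i
  let F : Finset (Fin N × Fin k →₀ ℕ) := (Finsupp.finite_of_degree_le d).toFinset
  refine ⟨∑ m ∈ F, MvPolynomial.rename (fun a : Fin N => (a, 0)) (Q m) *
    ∏ v : Fin N × Fin k, MvPolynomial.X (v.1, v.2.val + 1) ^ m v, fun ξ => ?_⟩
  rw [evalAt_eq_sum (S := F), map_sum]
  · refine Finset.sum_congr rfl fun m _ => ?_
    rw [hQ, map_mul, MvPolynomial.eval_rename, map_prod]
    simp [Function.comp_def]
  · intro m hm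
    refine coeff_eq_zero_of_lt_degree hs i _ ?_
    simpa [F] using hm

end Polynomial

end GreenGriffiths

namespace GreenGriffiths

/-! ### The basis of the space of sections -/

section Basis

variable {N k : ℕ}

/-- The derivatives of the homogeneous coordinates, when that of index `0` is `ε + t` and the
other ones are prescribed by `ξ`. -/
noncomputable def nearInfZ (ξ : Fin N × ℕ → ℂ) (ε : ℂ) : Fin (N + 1) → ℕ → ℂ :=
  Fin.cases (fun m => if m = 0 then ε else if m = 1 then 1 else 0) fun b m => ξ (b, m)

/-- The homogeneous coordinates of a curve whose derivatives of orders less than `n` are given by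
`nearInfZ`. -/
noncomputable def nearInfCurve (n : ℕ) (ξ : Fin N × ℕ → ℂ) (ε t : ℂ) : Fin (N + 1) → ℂ :=
  Fin.cases (ε + t) fun b => polyOfJet n (fun l => ξ (b, l)) t

@[simp] theorem nearInfCurve_zero (n : ℕ) (ξ : Fin N × ℕ → ℂ) (ε t : ℂ) :
    nearInfCurve n ξ ε t 0 = ε + t := rfl

@[simp] theorem nearInfCurve_succ (n : ℕ) (ξ : Fin N × ℕ → ℂ) (ε t : ℂ) (b : Fin N) :
    nearInfCurve n ξ ε t b.succ = polyOfJet n (fun l => ξ (b, l)) t := rfl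

theorem analyticAt_nearInfCurve (n : ℕ) (ξ : Fin N × ℕ → ℂ) (ε : ℂ) (l : Fin (N + 1)) :
    AnalyticAt ℂ (fun t => nearInfCurve n ξ ε t l) 0 := by
  induction l using Fin.cases with
  | zero =>
    simp only [nearInfCurve_zero]
    fun_prop
  | succ b => exact analyticAt_polyOfJet _ _

theorem iteratedDeriv_nearInfCurve {n m : ℕ} (hm : m < n) (ξ : Fin N × ℕ → ℂ) (ε : ℂ)
    (l : Fin (N + 1)) :
    iteratedDeriv m (fun t => nearInfCurve n ξ ε t l) 0 = nearInfZ ξ ε l m := by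
  induction l using Fin.cases with
  | zero =>
    simp only [nearInfCurve_zero, nearInfZ, Fin.cases_zero]
    rcases m with _ | m
    · simp
    · rw [iteratedDeriv_const_add (Nat.succ_pos m), iteratedDeriv_fun_id_zero]
      simp
  | succ b => exact iteratedDeriv_polyOfJet hm _

/-- Divide the homogeneous coordinates by X_0 = ε + t, whose value at t = 0 is ε. -/
theorem det_hmat_nearInfZ {α : Fin N → Finset ℕ} (hα : α ∈ BPlus N) {D n : ℕ}
    (hD : ∀ q ∈ columns α, q.2 < D) (hn : D ≤ n) (ξ : Fin N × ℕ → ℂ) {ε : ℂ} (hε : ε ≠ 0) :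
    (hmat α D (nearInfZ ξ ε)).det =
      ε ^ D * MvPolynomial.eval (homJet 0 (nearInfCurve n ξ ε)) (Delta0 α).det := by
  have h1 := eval_det_hmat_chartZ (α := α) (d := D) 0
    (fun l m => iteratedDeriv m (fun t => nearInfCurve n ξ ε t l / nearInfCurve n ξ ε t 0) 0)
    (fun m => by
      have hev : (fun t => nearInfCurve n ξ ε t 0 / nearInfCurve n ξ ε t 0) =ᶠ[nhds 0]
          fun _ => (1 : ℂ) := by
        have := (analyticAt_nearInfCurve n ξ ε 0).continuousAt.eventually_ne (by simpa using hε)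
        filter_upwards [this] with t ht
        exact div_self ht
      rw [hev.iteratedDeriv_eq, iteratedDeriv_const])
  rw [chartZ_zero, det_hmat_genericZ_zero (length_columns_le hα hD)] at h1
  unfold homJet
  rw [h1]
  have h2 := det_hmat_mul hD
    (Z := fun l m => iteratedDeriv m (fun t => nearInfCurve n ξ ε t l) 0)
    (Y := fun l m => iteratedDeriv m
      (fun t => nearInfCurve n ξ ε t l / nearInfCurve n ξ ε t 0) 0)
    (u := fun m => iteratedDeriv m (fun t => nearInfCurve n ξ ε t 0) 0) (fun l m _ => by
      have h0 : nearInfCurve n ξ ε 0 0 ≠ 0 := by simpa using hε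
      have hev : (fun t => nearInfCurve n ξ ε t l) =ᶠ[nhds 0]
          fun t => nearInfCurve n ξ ε t 0 *
            (nearInfCurve n ξ ε t l / nearInfCurve n ξ ε t 0) := by
        have := (analyticAt_nearInfCurve n ξ ε 0).continuousAt.eventually_ne h0
        filter_upwards [this] with t ht
        field_simp
      rw [hev.iteratedDeriv_eq]
      exact iteratedDeriv_fun_mul (analyticAt_nearInfCurve n ξ ε 0).contDiffAt
        ((analyticAt_nearInfCurve n ξ ε l).fun_div
          (analyticAt_nearInfCurve n ξ ε 0) h0).contDiffAt)
  rw [det_hmat_congr hD (Z' := nearInfZ ξ ε) fun l m hm =>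
    iteratedDeriv_nearInfCurve (lt_of_lt_of_le hm hn) ξ ε l] at h2
  rw [h2]
  simp

/-- Only the coordinate (ε + t)/x_a depends on ε, so in this chart the jet is affine in ε and stays
regular at ε = 0. -/
theorem homJet_nearInfCurve {n : ℕ} (hn : 0 < n) {ξ : Fin N × ℕ → ℂ} {a : Fin N}
    (ha : ξ (a, 0) ≠ 0) :
    ∃ η₀ η₁ : Fin N × ℕ → ℂ, ∀ ε, homJet a.succ (nearInfCurve n ξ ε) = η₀ + ε • η₁ := by
  classical
  set p := polyOfJet n fun l => ξ (a, l) with hp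
  have hp0 : p 0 ≠ 0 := by
    rw [hp, polyOfJet_zero hn]
    exact ha
  have hpa : AnalyticAt ℂ p 0 := analyticAt_polyOfJet _ _
  refine ⟨homJet a.succ (nearInfCurve n ξ 0), fun q => if a.succ.succAbove q.1 = 0 then
    iteratedDeriv q.2 (fun t => (p t)⁻¹) 0 else 0, fun ε => ?_⟩
  funext q
  simp only [homJet, Pi.add_apply, Pi.smul_apply, smul_eq_mul, nearInfCurve_succ, ← hp]
  split_ifs with h
  · simp only [h, nearInfCurve_zero, zero_add]
    have h1 : (fun t => (ε + t) / p t) = fun t => t / p t + ε * (p t)⁻¹ := by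
      funext t
      rw [div_eq_mul_inv, div_eq_mul_inv]
      ring
    rw [h1, iteratedDeriv_fun_add, iteratedDeriv_const_mul_field]
    · exact (analyticAt_id.fun_div hpa hp0).contDiffAt
    · exact (analyticAt_const.mul (hpa.fun_inv hp0)).contDiffAt
  · obtain ⟨b, hb⟩ := Fin.exists_succ_eq.2 h
    simp only [← hb, nearInfCurve_succ, mul_zero, add_zero]

theorem nearInfZ_zero (ξ : Fin N × ℕ → ℂ) :
    nearInfZ ξ 0 = fun l m => MvPolynomial.eval ξ (genericZ N 1 l m) := by
  funext l m
  induction l using Fin.cases with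
  | zero =>
    simp only [nearInfZ, Fin.cases_zero, genericZ_zero]
    rcases m with _ | _ | m <;> simp
  | succ b => simp [nearInfZ]

theorem continuous_det_hmat_nearInfZ (α : Fin N → Finset ℕ) (D : ℕ) (ξ : Fin N × ℕ → ℂ) :
    Continuous fun ε => (hmat α D (nearInfZ ξ ε)).det := by
  refine Continuous.matrix_det ?_
  refine continuous_matrix fun r c => ?_
  simp only [hmat, Matrix.of_apply]
  refine continuous_const.mul ?_
  generalize (extCol α c).1 = l
  induction l using Fin.cases with
  | zero =>
    simp only [nearInfZ, Fin.cases_zero]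
    split_ifs <;> fun_prop
  | succ b => exact continuous_const

theorem sum_det_hmat_genericZ_one_eq_zero {d D : ℕ} (hdD : d < D) {s : LocalFamily N k}
    (hs : s ∈ H0 N k d) {t : Finset (Fin N → Finset ℕ)} {g : (Fin N → Finset ℕ) → ℂ}
    (ht : ∀ α ∈ t, α ∈ BPlus N) (htD : ∀ α ∈ t, ∀ q ∈ columns α, q.2 < D)
    (hgiven : IsGivenBy (s 0) (∑ α ∈ t, g α • (Delta0 α).det)) (a : Fin N) :
    ∑ α ∈ t, g α • (hmat α D (genericZ N 1)).det = 0 := by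
  have key : ∀ ξ : Fin N × ℕ → ℂ, ξ (a, 0) ≠ 0 →
      MvPolynomial.eval ξ (∑ α ∈ t, g α • (hmat α D (genericZ N 1)).det) = 0 := by
    intro ξ ha
    obtain ⟨P, hP⟩ := isPolynomial_of_mem_H0 hs a.succ
    have hn : 0 < D := by omega
    obtain ⟨η₀, η₁, hη⟩ := homJet_nearInfCurve hn ha
    have h1 : (fun ε : ℂ => ∑ α ∈ t, g α * (hmat α D (nearInfZ ξ ε)).det) =
        fun ε => ε ^ (D - d) * (ξ (a, 0) ^ d * MvPolynomial.eval (η₀ + ε • η₁) P) := by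
      -- The identity is checked for ε ≠ 0 and reaches ε = 0 by continuity; there D > d makes the
      -- right side zero.
      refine Continuous.ext_on (dense_compl_singleton (0 : ℂ)) ?_ ?_ fun ε hε => ?_
      · exact continuous_finsetSum _ fun α _ =>
          continuous_const.mul (continuous_det_hmat_nearInfZ α D ξ)
      · have : Continuous fun ε : ℂ => MvPolynomial.eval (η₀ + ε • η₁) P :=
          (MvPolynomial.continuous_eval P).comp (by fun_prop)
        fun_prop
      · have hε0 : ε ≠ 0 := hε
        have h2 := hgiven (homJet 0 (nearInfCurve D ξ ε))
        have h3 := evalAt_homJet hs.2.2 0 a.succ (analyticAt_nearInfCurve D ξ ε)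
          (by simpa using hε0) (by simpa [polyOfJet_zero hn] using ha)
        have h4 := hP (homJet a.succ (nearInfCurve D ξ ε))
        rw [← evalAt] at h2 h4
        rw [h3, h4, hη, map_sum] at h2
        simp only [nearInfCurve_zero, add_zero, nearInfCurve_succ, polyOfJet_zero hn] at h2
        have h5 : ∑ α ∈ t, g α * (hmat α D (nearInfZ ξ ε)).det = ε ^ D * ∑ α ∈ t,
            MvPolynomial.eval (homJet 0 (nearInfCurve D ξ ε)) (g α • (Delta0 α).det) := by
          rw [Finset.mul_sum]
          refine Finset.sum_congr rfl fun α hα => ?_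
          rw [det_hmat_nearInfZ (ht α hα) (htD α hα) le_rfl ξ hε0, MvPolynomial.smul_eval]
          ring
        rw [h5, ← h2, div_pow]
        have h6 : ε ^ D = ε ^ (D - d) * ε ^ d := by
          rw [← pow_add, Nat.sub_add_cancel hdD.le]
        rw [h6]
        field_simp
    have h2 := congrFun h1 0
    simp only [zero_pow (show D - d ≠ 0 by omega), zero_mul, nearInfZ_zero] at h2
    rw [map_sum, ← h2]
    refine Finset.sum_congr rfl fun α _ => ?_
    rw [MvPolynomial.smul_eval, map_det_hmat]
  have h1 : MvPolynomial.X (a, 0) * ∑ α ∈ t, g α • (hmat α D (genericZ N 1)).det = 0 := by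
    refine MvPolynomial.funext fun ξ => ?_
    rw [map_mul, MvPolynomial.eval_X, map_zero, mul_eq_zero]
    by_cases h : ξ (a, 0) = 0
    · exact Or.inl h
    · exact Or.inr (key ξ h)
  exact (mul_eq_zero.1 h1).resolve_left (MvPolynomial.X_ne_zero _)

/-- On line D the binomials of the columns of α vanish, and an added column could only contribute
X_0 itself, which is zero at t = 0 when X_0 = t. -/
theorem det_hmat_genericZ_one_eq_zero {α : Fin N → Finset ℕ} {D : ℕ}
    (hD : ∀ q ∈ columns α, q.2 < D) : (hmat α (D + 1) (genericZ N 1)).det = 0 := by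
  refine Matrix.det_eq_zero_of_row_eq_zero (Fin.last D) fun c => ?_
  simp only [hmat, Matrix.of_apply, Fin.val_last]
  by_cases hc : c.val < (columns α).length
  · simp only [extCol, dif_pos hc]
    rw [Nat.choose_eq_zero_of_lt (hD _ (List.getElem_mem hc)), Nat.cast_zero, zero_mul]
  · simp only [extCol, dif_neg hc, genericZ_zero]
    rw [if_neg (by omega), mul_zero]

theorem snd_lt_of_isGivenBy {d : ℕ} {s : LocalFamily N k} (hs : s ∈ H0 N k d)
    {t : Finset (Fin N → Finset ℕ)} {g : (Fin N → Finset ℕ) → ℂ} (ht : ∀ α ∈ t, α ∈ BPlus N)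
    (hg : ∀ α ∈ t, g α ≠ 0) (hgiven : IsGivenBy (s 0) (∑ α ∈ t, g α • (Delta0 α).det)) :
    ∀ α ∈ t, ∀ q ∈ columns α, q.2 < d := by
  classical
  intro α hα q hq
  obtain ⟨q₁, hq₁, hmax⟩ := (t.biUnion fun α => (columns α).toFinset).exists_max_image
    (fun q => q.2) ⟨q, Finset.mem_biUnion.2 ⟨α, hα, List.mem_toFinset.2 hq⟩⟩
  have hle : ∀ β ∈ t, ∀ p ∈ columns β, p.2 ≤ q₁.2 := fun β hβ p hp =>
    hmax p (Finset.mem_biUnion.2 ⟨β, hβ, List.mem_toFinset.2 hp⟩)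
  obtain ⟨α₁, hα₁, hqα₁⟩ := Finset.mem_biUnion.1 hq₁
  rw [List.mem_toFinset] at hqα₁
  by_contra hlt
  have hdD : d < q₁.2 + 1 := by
    have := hle α hα q hq
    omega
  have h1 := sum_det_hmat_genericZ_one_eq_zero hdD hs ht
    (fun β hβ p hp => Nat.lt_succ_of_le (hle β hβ p hp)) hgiven q₁.1
  have hLI := linearIndependent_iff'.1 (linearIndependent_det_hmat_genericZ_one N q₁.2)
  let p : (Fin N → Finset ℕ) → Prop := fun α => α ∈ BPlus N ∧
    (∀ q ∈ columns α, q.2 < q₁.2 + 1) ∧ ∃ q ∈ columns α, q.2 = q₁.2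
  have h2 := hLI (t.subtype p) (fun α => g α.1) (by
    rw [Finset.sum_subtype_eq_sum_filter (p := p) (s := t)
      fun α => g α • (hmat α (q₁.2 + 1) (genericZ N 1)).det, Finset.sum_filter_of_ne, h1]
    intro β hβ hne
    refine ⟨ht β hβ, fun r hr => Nat.lt_succ_of_le (hle β hβ r hr), ?_⟩
    by_contra! hcon
    refine hne ?_
    rw [det_hmat_genericZ_one_eq_zero, smul_zero]
    exact fun r hr => lt_of_le_of_ne (hle β hβ r hr) (hcon r hr))
    ⟨α₁, ht α₁ hα₁, fun r hr => Nat.lt_succ_of_le (hle α₁ hα₁ r hr), q₁, hqα₁, rfl⟩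
    (Finset.mem_subtype.2 hα₁)
  exact hg α₁ hα₁ h2

/-- The polynomial of s_j vanishes wherever X_0/X_j ≠ 0, so its product with that coordinate is
zero. -/
theorem eq_zero_of_evalAt_zero {d : ℕ} {s : LocalFamily N k} (hs : s ∈ H0 N k d)
    (h0 : ∀ ξ, evalAt (s 0) ξ = 0) : s = 0 := by
  have key : ∀ (j : Fin (N + 1)) (ξ : Fin N × ℕ → ℂ), evalAt (s j) ξ = 0 := by
    intro j
    by_cases hj : 0 = j
    · rw [← hj]
      exact h0
    obtain ⟨b, hb⟩ := Fin.exists_succAbove_eq hj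
    obtain ⟨P, hP⟩ := isPolynomial_of_mem_H0 hs j
    have h1 : MvPolynomial.X (b, 0) * P = 0 := by
      refine MvPolynomial.funext fun ξ => ?_
      rw [map_mul, MvPolynomial.eval_X, map_zero, mul_eq_zero]
      by_cases h : ξ (b, 0) = 0
      · exact Or.inl h
      · right
        rw [← hP ξ, ← evalAt]
        have h2 := evalAt_homJet_scaledCurve (s j) j ξ 1
        rw [one_smul] at h2
        rw [← h2, evalAt_homJet hs.2.2 j 0 (analyticAt_scaledCurve j ξ 1) (by simp) ?_, h0,
          mul_zero]
        rw [← hb, scaledCurve_succAbove, one_mul, polyOfJet_zero (Nat.succ_pos k)]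
        exact h
    have h2 := (mul_eq_zero.1 h1).resolve_left (MvPolynomial.X_ne_zero _)
    intro ξ
    rw [evalAt, hP ξ, h2, map_zero]
  funext j x
  refine MvPolynomial.funext fun y => ?_
  have h1 := key j fun v => if v.2 = 0 then x v.1 else
    if h : v.2 - 1 < k then y (v.1, ⟨v.2 - 1, h⟩) else 0
  simpa [evalAt] using h1

/-- The value of the local section of index `0` at a jet, as a linear form. -/
noncomputable def evalZero (N k : ℕ) (ξ : Fin N × ℕ → ℂ) : LocalFamily N k →ₗ[ℂ] ℂ where
  toFun s := evalAt (s 0) ξ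
  map_add' s t := by simp [evalAt]
  map_smul' c s := by simp [evalAt, MvPolynomial.smul_eval]

theorem evalZero_sum_detFamily {d : ℕ} (hk : d - 1 ≤ k) {ι : Type*} (t : Finset ι) (g : ι → ℂ)
    (α : ι → Fin N → Finset ℕ) (ht : ∀ i ∈ t, α i ∈ BPlus N)
    (htd : ∀ i ∈ t, ∀ q ∈ columns (α i), q.2 < d) (ξ : Fin N × ℕ → ℂ) :
    evalZero N k ξ (∑ i ∈ t, g i • detFamily k d (α i)) =
      MvPolynomial.eval ξ (∑ i ∈ t, g i • (Delta0 (α i)).det) := by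
  rw [map_sum, map_sum]
  refine Finset.sum_congr rfl fun i hi => ?_
  rw [map_smul, MvPolynomial.smul_eval, smul_eq_mul]
  congr 1
  exact isGivenBy_detFamily_zero hk (ht i hi) (htd i hi) ξ

theorem snd_lt_of_maxTerm_le {d : ℕ} (hd : 1 ≤ d) {α : Fin N → Finset ℕ}
    (h : maxTerm α ≤ d - 1) : ∀ q ∈ columns α, q.2 < d := fun q hq => by
  have := maxTerm_le_iff.1 h q hq
  omega

theorem exists_basis (N : ℕ) {d k : ℕ} (hd : 1 ≤ d) (hk : d - 1 ≤ k) :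
    ∃ b : Module.Basis {α : Fin N → Finset ℕ // α ∈ BPlus N ∧ maxTerm α ≤ d - 1} ℂ (H0 N k d),
      ∀ α, (b α : LocalFamily N k) = detFamily k d α.1 := by
  classical
  let S : {α : Fin N → Finset ℕ // α ∈ BPlus N ∧ maxTerm α ≤ d - 1} → H0 N k d := fun α =>
    ⟨detFamily k d α.1, detFamily_mem_H0 hk (snd_lt_of_maxTerm_le hd α.2.2)⟩
  have hLI : LinearIndependent ℂ S := by
    rw [linearIndependent_iff']
    intro t g hg
    refine linearIndependent_iff'.1 (linearIndependent_det_Delta0 N d hd) t g ?_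
    refine MvPolynomial.funext fun ξ => ?_
    rw [← evalZero_sum_detFamily hk t g (fun α => α.1) (fun α _ => α.2.1)
      (fun α _ => snd_lt_of_maxTerm_le hd α.2.2), map_zero]
    have h1 := congrArg (Subtype.val) hg
    rw [AddSubmonoidClass.coe_finsetSum] at h1
    have h2 : ∑ α ∈ t, g α • detFamily k d α.1 = 0 := h1
    rw [h2, map_zero]
  have hspan : ⊤ ≤ Submodule.span ℂ (Set.range S) := by
    rintro ⟨s, hs⟩ -
    obtain ⟨P, hP⟩ := isPolynomial_of_mem_H0 hs 0
    have hmem : P ∈ Submodule.span ℂ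
        ((fun α : Fin N → Finset ℕ => (Delta0 α).det) '' BPlus N) := by
      rw [span_det_Delta0]
      exact Submodule.mem_top
    obtain ⟨l, hl, rfl⟩ := (Finsupp.mem_span_image_iff_linearCombination ℂ).1 hmem
    rw [Finsupp.mem_supported] at hl
    rw [Finsupp.linearCombination_apply, Finsupp.sum] at hP
    have hlt := snd_lt_of_isGivenBy hs (fun α hα => hl hα)
      (fun α hα => Finsupp.mem_support_iff.1 hα) hP
    have hmaxTerm : ∀ α ∈ l.support, maxTerm α ≤ d - 1 := fun α hα =>
      maxTerm_le_iff.2 fun q hq => Nat.le_sub_one_of_lt (hlt α hα q hq)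
    have heq : s = ∑ α ∈ l.support, l α • detFamily k d α := by
      rw [← sub_eq_zero]
      refine eq_zero_of_evalAt_zero (d := d) (Submodule.sub_mem _ hs (Submodule.sum_mem _
        fun α hα => Submodule.smul_mem _ _ (detFamily_mem_H0 hk (hlt α hα)))) fun ξ => ?_
      have h1 : evalZero N k ξ (s - ∑ α ∈ l.support, l α • detFamily k d α) = 0 := by
        rw [map_sub, evalZero_sum_detFamily hk l.support l (fun α => α) (fun α hα => hl hα) hlt,
          sub_eq_zero]
        exact hP ξ
      exact h1
    have heq2 : (⟨s, hs⟩ : H0 N k d) = ∑ α ∈ l.support.attach,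
        l α.1 • S ⟨α.1, hl α.2, hmaxTerm α.1 α.2⟩ := by
      apply Subtype.ext
      rw [AddSubmonoidClass.coe_finsetSum]
      exact heq.trans (Finset.sum_attach l.support fun α => l α • detFamily k d α).symm
    rw [heq2]
    exact Submodule.sum_mem _ fun α _ => Submodule.smul_mem _ _ (Submodule.subset_span ⟨_, rfl⟩)
  exact ⟨Module.Basis.mk hLI hspan, fun α => by rw [Module.Basis.mk_apply]⟩

end Basis

end GreenGriffiths

theorem mainTheorem1 (N d k : ℕ) (hd : 1 ≤ d) (hk : d - 1 ≤ k) :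
    Module.finrank ℂ (GreenGriffiths.H0 N k d) = (N + 1) ^ d ∧
    (∃ b : Module.Basis
        {α : Fin N → Finset ℕ // α ∈ GreenGriffiths.BPlus N ∧ GreenGriffiths.maxTerm α ≤ d - 1}
        ℂ (GreenGriffiths.H0 N k d),
      ∀ α, GreenGriffiths.IsGivenBy ((b α : GreenGriffiths.LocalFamily N k) 0)
        (GreenGriffiths.Delta0 α.1).det) ∧
    ∀ s ∈ GreenGriffiths.H0 N k d, GreenGriffiths.IsPolynomial s := by
  obtain ⟨b, hb⟩ := GreenGriffiths.exists_basis N hd hk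
  refine ⟨?_, ⟨b, fun α => ?_⟩, fun s hs => GreenGriffiths.isPolynomial_of_mem_H0 hs⟩
  · rw [Module.finrank_eq_nat_card_basis b, (GreenGriffiths.card_BPlus hd).1]
  · rw [hb]
    exact GreenGriffiths.isGivenBy_detFamily_zero hk α.2.1
      (GreenGriffiths.snd_lt_of_maxTerm_le hd α.2.2)
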